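/- In the game $0.33$ on a connected finite graph, two players alternately remove one vertex or two adjacent vertices so that the remaining graph is empty or connected; the player who moves last wins. Let $\mathcal G$ denote the Grundy value and write $J_1\equiv J_2$ if the disjoint sum $J_1+J_2$ is a win for the second player. A subdivided star is either the empty graph $\emptyset$ or $S_{\ell_1,\dots,\ell_k}$ ($k\ge 0$, $\ell_i\ge 1$), a central vertex to which paths with $\ell_1,\dots,\ell_k$ vertices are attached. For subdivided stars $S,S'$, let $S\overset{2}{-}S'$ be the graph obtained by adding one new vertex and joining it to the central vertex of each nonempty one among $S,S'$. Write $S\sim_2 S'$ if $S\overset{2}{-}\hat S\equiv S'\overset{2}{-}\hat S$ for every subdivided star $\hat S$. The reduction of $S_{\ell_1,\dots,\ell_k}$ is the star obtained by replacing each $\ell_i$ by $\ell_i \bmod 3$ and dropping the paths of length $0$; $\emptyset$ is its own reduction. Let $t(S)$ be the number of paths of length $2$ in the reduction of $S$ (the number of $i$ with $\ell_i\equiv 2 \pmod 3$; $t(\emptyset)=0$), and let $P_1$, $P_2=S_1$ be the stars with $k=0$ and with $k=1,\ \ell_1=1$. Define the following sets of subdivided stars: - $\mathcal D_0^*$: $\mathcal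 G(S)=0$ and $t(S)\in\{0,2\}$, or the reduction of $S$ is $S_2$; - $\mathcal D_1^*$: the reduction of $S$ is $P_1$, $S_{2,1}$ or $S_{2,2,2}$; - $\mathcal D_1^{\Box}$: $\mathcal G(S)=1$, $t(S)\in\{0,2\}$ and the reduction of $S$ is not $P_1$; - $\mathcal D_2^*$: the reduction of $S$ is $P_2$ or $S_{2,2}$; - $\mathcal D_2^{\Box}$: $\mathcal G(S)=2$ and $t(S)\in\{1,3\}$; - $\mathcal D_3^{\Box}$: $\mathcal G(S)=3$ and $t(S)\in\{1,3\}$; - for $i\in\{0,1,2,3\}$, $\mathcal D_i$: $\mathcal G(S)=i$ and $S$ is in none of the six previous sets. Then $\sim_2$ is an equivalence relation, the ten sets $\mathcal D_0,\mathcal D_0^*,\mathcal D_1,\mathcal D_1^*,\mathcal D_1^{\Box},\mathcal D_2,\mathcal D_2^*,\mathcal D_2^{\Box},\mathcal D_3,\mathcal D_3^{\Box}$ are pairwise distinct, and they are exactly its equivalence classes. Moreover, $\mathcal G(S\overset{2}{-}S')$ is given by the following table, according to the class of $S$ (row) and of $S'$ (column), where $\oplus$ means $\mathcal G(S)\oplus\mathcal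 G(S')$ (nim-sum) and $\oplus_1$ means $\mathcal G(S)\oplus\mathcal G(S')\oplus 1$: $$\begin{array}{c|c|c|c|c|c|c|c|c|c|c} &\mathcal D_0 & \mathcal D_0^* & \mathcal D_1 & \mathcal D_1^* & \mathcal D_1^{\Box} & \mathcal D_2 & \mathcal D_2^* & \mathcal D_2^{\Box} & \mathcal D_3 & \mathcal D_3^{\Box} \\ \hline \mathcal D_0 & \oplus & \oplus_1 & \oplus & 2 & \oplus_1 & \oplus & 0 & \oplus_1 & \oplus & \oplus_1 \\ \mathcal D_0^* & \oplus_1 & \oplus_1 & \oplus_1 & 2 & \oplus_1 & \oplus_1 & 0 & \oplus_1 & \oplus_1 & \oplus_1 \\ \mathcal D_1 & \oplus & \oplus_1 & \oplus & 3 & \oplus_1 & \oplus & 1 & \oplus_1 & \oplus & \oplus_1 \\ \mathcal D_1^* & 2 & 2 & 3 & 0 & 3 & 0 & 1 & 1 & 1 & 0 \\ \mathcal D_1^{\Box} & \oplus_1 & \oplus_1 & \oplus_1 & 3 & \oplus_1 & \oplus_1 & 1 & \oplus_1 & \oplus_1 & \oplus_1 \\ \mathcal D_2 & \oplus & \oplus_1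 & \oplus & 0 & \oplus_1 & \oplus & 2 & \oplus_1 & \oplus & \oplus_1 \\ \mathcal D_2^* & 0 & 0 & 1 & 1 & 1 & 2 & 2 & 2 & 3 & 3 \\ \mathcal D_2^{\Box} & \oplus_1 & \oplus_1 & \oplus_1 & 1 & \oplus_1 & \oplus_1 & 2 & 0 & \oplus_1 & 1 \\ \mathcal D_3 & \oplus & \oplus_1 & \oplus & 1 & \oplus_1 & \oplus & 3 & \oplus_1 & \oplus & \oplus_1 \\ \mathcal D_3^{\Box} & \oplus_1 & \oplus_1 & \oplus_1 & 0 & \oplus_1 & \oplus_1 & 3 & 1 & \oplus_1 & 0 \end{array}$$ -/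

import Mathlib

/-! ### Impartial games in normal play

A game is given by a relation `opt` on positions, `opt q p` meaning that `q` is an option of `p`. -/

/-- `PPosition opt p`: the second player wins from `p`, i.e. every move from `p` has a reply leading
to a position of the same kind. -/
inductive PPosition {P : Type*} (opt : P → P → Prop) : P → Prop
  | intro (p : P) (reply : ∀ q, opt q p → P)
      (legal : ∀ q (h : opt q p), opt (reply q h) q)
      (wins : ∀ q (h : opt q p), PPosition opt (reply q h)) : PPosition opt p

/-- The smallest nonnegative integer not in `s`. -/
noncomputable def mex (s : Set ℕ) : ℕ := sInf sᶜ

/-- The Grundy value: the mex of the Grundy values of the options. -/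
noncomputable def grundy {P : Type*} (opt : P → P → Prop) [IsWellFounded P opt] : P → ℕ :=
  IsWellFounded.fix opt fun p g => mex {n | ∃ q, ∃ h : opt q p, g q h = n}

/-! ### The game 0.33 on a connected graph -/

/-- Positions of the game 0.33 on a connected graph `G` are the sets of remaining vertices.
`OctalMove G W' W`: one passes from `W` to `W'` by removing a set `X` made of one vertex or of two
adjacent vertices, so that the remaining graph is not disconnected (it may be empty). -/
def OctalMove {V : Type*} [DecidableEq V] (G : SimpleGraph V) (W' W : Finset V) : Prop :=
  ∃ X ⊆ W, (X.card = 1 ∨ X.card = 2) ∧ (G.induce (X : Set V)).Connected ∧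
    W' = W \ X ∧ (G.induce (W' : Set V)).Preconnected

instance OctalMove.isWellFounded {V : Type*} [DecidableEq V] (G : SimpleGraph V) :
    IsWellFounded (Finset V) (OctalMove G) where
  wf := by
    refine Subrelation.wf (r := fun A B : Finset V => A.card < B.card) ?_
      (measure Finset.card).wf
    rintro W' W ⟨X, hXW, hX, -, rfl, -⟩
    have h := Finset.card_sdiff_add_card_eq_card hXW
    show (W \ X).card < W.card
    omega

/-- The Grundy value of the game 0.33 played on the graph `G`. -/
noncomputable def grundyValue {V : Type*} [DecidableEq V] [Fintype V] (G : SimpleGraph V) : ℕ :=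
  grundy (OctalMove G) Finset.univ

/-- `G ≡ H`: the disjoint sum of the games 0.33 on `G` and on `H` is a P-position. -/
def GameEquiv {V V' : Type*} [DecidableEq V] [Fintype V] [DecidableEq V'] [Fintype V']
    (G : SimpleGraph V) (H : SimpleGraph V') : Prop :=
  PPosition (Prod.GameAdd (OctalMove G) (OctalMove H)) (Finset.univ, Finset.univ)

/-! ### Subdivided stars -/

/-- A subdivided star: either the empty graph or `S_{ℓ₁,…,ℓₖ}` with `k ≥ 0` and all `ℓᵢ ≥ 1`, made of
a central vertex to which paths with `ℓ₁, …, ℓₖ` vertices are attached. -/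
inductive SubdividedStar : Type
  | empty : SubdividedStar
  | star (paths : List ℕ) (pos : ∀ l ∈ paths, 1 ≤ l) : SubdividedStar

namespace SubdividedStar

/-- The vertices: `none` is the central vertex, and `some ⟨i, j⟩` is the vertex at distance `j + 1`
from the centre on the path number `i`. -/
def Vertex : SubdividedStar → Type
  | empty => Empty
  | star paths _ => Option ((i : Fin paths.length) × Fin (paths.get i))

instance : (S : SubdividedStar) → DecidableEq S.Vertex
  | empty => inferInstanceAs (DecidableEq Empty)
  | star paths _ => inferInstanceAs (DecidableEq (Option ((i : Fin paths.length) × Fin (paths.get i))))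

instance : (S : SubdividedStar) → Fintype S.Vertex
  | empty => inferInstanceAs (Fintype Empty)
  | star paths _ => inferInstanceAs (Fintype (Option ((i : Fin paths.length) × Fin (paths.get i))))

/-- `v` is the central vertex. -/
def IsCenter : (S : SubdividedStar) → S.Vertex → Prop
  | empty, _ => False
  | star _ _, v => v = none

/-- `Step S u v`: `v` is the neighbour of `u` that is farther from the centre. -/
def Step : (S : SubdividedStar) → S.Vertex → S.Vertex → Prop
  | empty, _, _ => False
  | star _ _, none, some ⟨_, j⟩ => j.val = 0
  | star _ _, some ⟨i, j⟩, some ⟨i', j'⟩ => i = i' ∧ j'.val = j.val + 1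
  | star _ _, _, none => False

/-- The subdivided star as a graph. -/
def graph (S : SubdividedStar) : SimpleGraph S.Vertex := SimpleGraph.fromRel S.Step

/-- One half of the adjacency of the bistar; `Sum.inr (Sum.inl ())` is the middle vertex. -/
def BistarStep (S S' : SubdividedStar) :
    S.Vertex ⊕ Unit ⊕ S'.Vertex → S.Vertex ⊕ Unit ⊕ S'.Vertex → Prop
  | Sum.inl u, Sum.inl v => S.graph.Adj u v
  | Sum.inr (Sum.inr u), Sum.inr (Sum.inr v) => S'.graph.Adj u v
  | Sum.inr (Sum.inl _), Sum.inl v => S.IsCenter v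
  | Sum.inr (Sum.inl _), Sum.inr (Sum.inr v) => S'.IsCenter v
  | _, _ => False

/-- The subdivided bistar whose middle path has two edges: the central vertices of `S` and `S'` are
joined through one middle vertex. If `S'` is empty, this is `S` with one more path, with one vertex,
attached to its centre; if both are empty, it is a single vertex. -/
def bistar (S S' : SubdividedStar) : SimpleGraph (S.Vertex ⊕ Unit ⊕ S'.Vertex) :=
  SimpleGraph.fromRel (BistarStep S S')

/-- The relation `S ∼₂ S'`. -/
def Sim2 (S S' : SubdividedStar) : Prop :=
  ∀ T : SubdividedStar, GameEquiv (S.bistar T) (S'.bistar T)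

/-- The Grundy value of the subdivided star. -/
noncomputable def value (S : SubdividedStar) : ℕ := grundyValue S.graph

/-- After reducing all path lengths modulo 3 and dropping the paths that become empty, `S` is
the (nonempty) star whose paths have the given lengths. -/
def ReducesTo : SubdividedStar → Multiset ℕ → Prop
  | empty, _ => False
  | star paths _, m => (((paths.map (· % 3)).filter (· ≠ 0) : List ℕ) : Multiset ℕ) = m

/-- The number of paths of length 2 after reduction of all path lengths modulo 3. -/
def numTwo : SubdividedStar → ℕ
  | empty => 0
  | star paths _ => (paths.map (· % 3)).count 2

end SubdividedStar

/-! ### The ten classes and the table -/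

/-- Names of the classes; the suffixes `s` and `b` stand for star and box. -/
inductive StarClass : Type
  | d0 | d0s | d1 | d1s | d1b | d2 | d2s | d2b | d3 | d3b

namespace StarClass

open SubdividedStar

/-- The six special classes (`False` for the four others). -/
def Special : StarClass → SubdividedStar → Prop
  | d0s, S => (S.value = 0 ∧ (S.numTwo = 0 ∨ S.numTwo = 2)) ∨ S.ReducesTo {2}
  | d1s, S => S.ReducesTo 0 ∨ S.ReducesTo {2, 1} ∨ S.ReducesTo {2, 2, 2}
  | d1b, S => S.value = 1 ∧ (S.numTwo = 0 ∨ S.numTwo = 2) ∧ ¬ S.ReducesTo 0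
  | d2s, S => S.ReducesTo {1} ∨ S.ReducesTo {2, 2}
  | d2b, S => S.value = 2 ∧ (S.numTwo = 1 ∨ S.numTwo = 3)
  | d3b, S => S.value = 3 ∧ (S.numTwo = 1 ∨ S.numTwo = 3)
  | _, _ => False

/-- The ten classes as sets of subdivided stars. -/
def stars : StarClass → Set SubdividedStar
  | d0 => {S | S.value = 0 ∧ ∀ c, ¬ Special c S}
  | d1 => {S | S.value = 1 ∧ ∀ c, ¬ Special c S}
  | d2 => {S | S.value = 2 ∧ ∀ c, ¬ Special c S}
  | d3 => {S | S.value = 3 ∧ ∀ c, ¬ Special c S}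
  | c => {S | Special c S}

/-- An entry of the table: a function of the Grundy values of the two stars. -/
abbrev Entry : Type := ℕ → ℕ → ℕ

/-- The nim-sum. -/
def X : Entry := fun x y => x ^^^ y

/-- The nim-sum, nim-added to 1. -/
def Y : Entry := fun x y => x ^^^ y ^^^ 1

/-- A constant entry. -/
def K (n : ℕ) : Entry := fun _ _ => n

/-- A row of the table, with columns ordered as the constructors of `StarClass`. -/
def row (e0 e0s e1 e1s e1b e2 e2s e2b e3 e3b : Entry) : StarClass → Entry
  | d0 => e0
  | d0s => e0s
  | d1 => e1
  | d1s => e1s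
  | d1b => e1b
  | d2 => e2
  | d2s => e2s
  | d2b => e2b
  | d3 => e3
  | d3b => e3b

/-- The table giving the Grundy value of the bistar. -/
def table : StarClass → StarClass → Entry
  --            d0    d0s   d1    d1s   d1b   d2    d2s   d2b   d3    d3b
  | d0  => row  X     Y     X     (K 2) Y     X     (K 0) Y     X     Y
  | d0s => row  Y     Y     Y     (K 2) Y     Y     (K 0) Y     Y     Y
  | d1  => row  X     Y     X     (K 3) Y     X     (K 1) Y     X     Y
  | d1s => row  (K 2) (K 2) (K 3) (K 0) (K 3) (K 0) (K 1) (K 1) (K 1) (K 0)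
  | d1b => row  Y     Y     Y     (K 3) Y     Y     (K 1) Y     Y     Y
  | d2  => row  X     Y     X     (K 0) Y     X     (K 2) Y     X     Y
  | d2s => row  (K 0) (K 0) (K 1) (K 1) (K 1) (K 2) (K 2) (K 2) (K 3) (K 3)
  | d2b => row  Y     Y     Y     (K 1) Y     Y     (K 2) (K 0) Y     (K 1)
  | d3  => row  X     Y     X     (K 1) Y     X     (K 3) Y     X     Y
  | d3b => row  Y     Y     Y     (K 0) Y     Y     (K 3) (K 1) Y     (K 0)

end StarClass

/-! ### Grundy values -/

/-! Everything depends only on the numbers `a`, `b` of paths of length 1 and 2 modulo 3. The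
function `ofCounts a b` names a class, is 2-periodic in `a` from 2 on and in `b` from 4 on, and the
empty star gets the class `d0s` of the star reducing to `S_2`. The claim is that a star has value
`val` of its class (`value_eq`) and a bistar has value `val₂` of its two classes
(`grundyValue_bistar`).

Both are proved by induction on positions, through the mex. No option has the claimed value:
shortening a path changes its residue, and for fixed other paths the three residues give pairwise
distinct entries in each column of the table (`val₂_joinPath_pairwise_ne`, a finite check by
periodicity). Moves that delete a centre or the middle vertex are compared with the same triples,
since `P_1`, `P_2` and the empty star have the classes of a single path of residue 0, 1, 2. Every
smaller value is attained: `kinds` lists, for each class, a few options that are always available up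
to small exceptions, and a finite check over pairs of kinds shows that they suffice
(`exists_of_lt_val₂`).

To enumerate legal moves, all stars and bistars are embedded in one tree rooted at the middle
vertex. There a set of vertices is connected or empty iff at most one of its vertices lacks its
parent (`preconnected_iff_rootUnique`), which makes legality a local condition.

Equality of Grundy values is equivalence of games (`gameEquiv_iff`), the rows of the table are
distinct and each class is inhabited, so `Sim2` is equality of classes. Finally a count of paths
identifies the sets of the statement with the fibres of `cls` (`mem_stars_iff`). -/

theorem mex_eq_of {s : Set ℕ} {v : ℕ} (h1 : v ∉ s) (h2 : ∀ u < v, u ∈ s) : mex s = v := by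
  refine le_antisymm (Nat.sInf_le h1) (le_csInf ⟨v, h1⟩ fun u hu => ?_)
  by_contra h
  exact hu (h2 u (not_le.1 h))

/-- Finiteness makes the complement nonempty; otherwise `mex s` would be the default value 0 of
`sInf`. -/
theorem mex_eq_iff {s : Set ℕ} (hs : s.Finite) {v : ℕ} :
    mex s = v ↔ v ∉ s ∧ ∀ u < v, u ∈ s := by
  have hne : sᶜ.Nonempty := hs.infinite_compl.nonempty
  constructor
  · rintro rfl
    refine ⟨Nat.sInf_mem hne, fun u hu => ?_⟩
    by_contra h
    exact absurd (Nat.sInf_le (s := sᶜ) h) (not_le.2 hu)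
  · rintro ⟨h1, h2⟩
    exact mex_eq_of h1 h2

section Grundy

variable {P : Type*} (opt : P → P → Prop) [IsWellFounded P opt]

theorem grundy_eq_mex (p : P) : grundy opt p = mex {n | ∃ q, opt q p ∧ grundy opt q = n} := by
  rw [grundy, IsWellFounded.fix_eq]
  congr 1
  ext n
  simp

variable {opt}

theorem grundy_eq_of {p : P} {v : ℕ} (h1 : ∀ q, opt q p → grundy opt q ≠ v)
    (h2 : ∀ u < v, ∃ q, opt q p ∧ grundy opt q = u) : grundy opt p = v := by
  rw [grundy_eq_mex]
  refine mex_eq_of ?_ h2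
  rintro ⟨q, hq, e⟩
  exact h1 q hq e

theorem grundy_spec (fin : ∀ p, {q | opt q p}.Finite) (p : P) :
    (∀ q, opt q p → grundy opt q ≠ grundy opt p) ∧
      ∀ u < grundy opt p, ∃ q, opt q p ∧ grundy opt q = u := by
  have hs : {n | ∃ q, opt q p ∧ grundy opt q = n}.Finite := (fin p).image (grundy opt)
  obtain ⟨h1, h2⟩ := (mex_eq_iff hs).1 (grundy_eq_mex opt p).symm
  exact ⟨fun q hq e => h1 ⟨q, hq, e⟩, h2⟩

end Grundy

/-! ### Sums of two games and equality of Grundy values -/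

section Sum

variable {P Q : Type*} {o : P → P → Prop} {o' : Q → Q → Prop}
  [IsWellFounded P o] [IsWellFounded Q o']
-- If the values differed, a move in the larger component could equalize them. The winning reply
-- would again lead to equal values by induction, yet a move in one component always changes its
-- value.
theorem PPosition.grundy_eq (fin : ∀ p, {q | o q p}.Finite) (fin' : ∀ p, {q | o' q p}.Finite)
    {z : P × Q} (h : PPosition (Prod.GameAdd o o') z) :
    grundy o z.1 = grundy o' z.2 := by
  induction h with
  | intro z reply legal _ ih =>
    obtain ⟨p, q⟩ := z
    obtain ⟨hp1, hp2⟩ := grundy_spec fin p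
    obtain ⟨hq1, hq2⟩ := grundy_spec fin' q
    rcases lt_trichotomy (grundy o p) (grundy o' q) with h | h | h
    · exfalso
      obtain ⟨q', hq', e⟩ := hq2 _ h
      have hm : Prod.GameAdd o o' (p, q') (p, q) := .snd hq'
      have l := legal _ hm
      have i := ih _ hm
      generalize reply _ hm = w at l i
      rcases l with ⟨h⟩ | ⟨h⟩
      · exact hp1 _ h (i.trans e)
      · exact (grundy_spec fin' q').1 _ h (i.symm.trans e.symm)
    · exact h
    · exfalso
      obtain ⟨p', hp', e⟩ := hp2 _ h
      have hm : Prod.GameAdd o o' (p', q) (p, q) := .fst hp'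
      have l := legal _ hm
      have i := ih _ hm
      generalize reply _ hm = w at l i
      rcases l with ⟨h⟩ | ⟨h⟩
      · exact (grundy_spec fin p').1 _ h (i.trans e.symm)
      · exact hq1 _ h (i.symm.trans e)

/-- A move that lowers one value is answered by lowering the other to match; a move that raises it
is reversed in the same component. -/
theorem PPosition.of_grundy_eq (fin : ∀ p, {q | o q p}.Finite) (fin' : ∀ p, {q | o' q p}.Finite)
    (z : P × Q) (h : grundy o z.1 = grundy o' z.2) :
    PPosition (Prod.GameAdd o o') z := by
  have wf : WellFounded (Prod.GameAdd o o') :=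
    WellFounded.prod_gameAdd (IsWellFounded.wf) (IsWellFounded.wf)
  -- The induction hypothesis is used two moves further on, after the reply, hence the transitive
  -- closure.
  induction z using wf.transGen.induction with
  | _ z ih =>
    have key : ∀ w, Prod.GameAdd o o' w z →
        ∃ r, Prod.GameAdd o o' r w ∧ PPosition (Prod.GameAdd o o') r := by
      intro w hw
      have : ∃ r, Prod.GameAdd o o' r w ∧ grundy o r.1 = grundy o' r.2 := by
        obtain ⟨p, q⟩ := z
        rcases hw with ⟨hm⟩ | ⟨hm⟩
        · rename_i p'
          rcases lt_or_gt_of_ne ((grundy_spec fin p).1 _ hm) with h' | h'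
          · obtain ⟨q', hq', e⟩ := (grundy_spec fin' q).2 _ (h ▸ h')
            exact ⟨(p', q'), .snd hq', e.symm⟩
          · obtain ⟨p'', hp'', e⟩ := (grundy_spec fin p').2 _ h'
            exact ⟨(p'', q), .fst hp'', e.trans h⟩
        · rename_i q'
          rcases lt_or_gt_of_ne ((grundy_spec fin' q).1 _ hm) with h' | h'
          · obtain ⟨p', hp', e⟩ := (grundy_spec fin p).2 _ (h ▸ h')
            exact ⟨(p', q'), .fst hp', e⟩
          · obtain ⟨q'', hq'', e⟩ := (grundy_spec fin' q').2 _ h'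
            exact ⟨(p, q''), .snd hq'', h.trans e.symm⟩
      obtain ⟨r, hr, e⟩ := this
      exact ⟨r, hr, ih r (.tail (.single hr) hw) e⟩
    choose r hr hr' using key
    exact .intro z r hr hr'

end Sum

/-! ### The game 0.33 under graph embeddings -/

section OctalMove

variable {V V' : Type*} [DecidableEq V] [DecidableEq V']

theorem OctalMove.subset {G : SimpleGraph V} {W' W : Finset V} (h : OctalMove G W' W) :
    W' ⊆ W := by
  obtain ⟨X, -, -, -, rfl, -⟩ := h
  exact Finset.sdiff_subset

theorem OctalMove.finite (G : SimpleGraph V) (W : Finset V) : {W' | OctalMove G W' W}.Finite :=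
  W.powerset.finite_toSet.subset fun _ h => Finset.mem_coe.2 (Finset.mem_powerset.2 h.subset)

theorem gameEquiv_iff [Fintype V] [Fintype V'] (G : SimpleGraph V) (H : SimpleGraph V') :
    GameEquiv G H ↔ grundyValue G = grundyValue H :=
  ⟨fun h => h.grundy_eq (OctalMove.finite G) (OctalMove.finite H),
    fun h => .of_grundy_eq (OctalMove.finite G) (OctalMove.finite H) _ h⟩

/-- A graph embedding identifies the graph induced on a set with the graph induced on its image. -/
noncomputable def induceMapIso {G : SimpleGraph V} {H : SimpleGraph V'} (φ : G ↪g H)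
    (W : Finset V) :
    G.induce (W : Set V) ≃g H.induce ((W.map φ.toEmbedding : Finset V') : Set V') where
  toEquiv := Equiv.ofBijective
    (fun x => ⟨φ x, by simp⟩) <| by
      constructor
      · rintro ⟨x, hx⟩ ⟨y, hy⟩ h
        simpa using h
      · rintro ⟨y, hy⟩
        obtain ⟨x, hx, rfl⟩ := Finset.mem_map.1 (Finset.mem_coe.1 hy)
        exact ⟨⟨x, hx⟩, rfl⟩
  map_rel_iff' := by
    intro x y
    simp

theorem octalMove_map {G : SimpleGraph V} {H : SimpleGraph V'} (φ : G ↪g H)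
    {W' W : Finset V} :
    OctalMove H (W'.map φ.toEmbedding) (W.map φ.toEmbedding) ↔ OctalMove G W' W := by
  constructor
  · rintro ⟨X, hX, hc, hconn, e, hpre⟩
    obtain ⟨X, hXW, rfl⟩ := Finset.subset_map_iff.1 hX
    refine ⟨X, hXW, by simpa using hc, (induceMapIso φ X).connected_iff.2 hconn, ?_,
      (induceMapIso φ W').preconnected_iff.2 hpre⟩
    rwa [← Finset.map_sdiff, Finset.map_inj] at e
  · rintro ⟨X, hX, hc, hconn, rfl, hpre⟩
    refine ⟨X.map φ.toEmbedding, Finset.map_subset_map.2 hX, by simpa using hc,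
      (induceMapIso φ X).connected_iff.1 hconn, Finset.map_sdiff ..,
      (induceMapIso φ _).preconnected_iff.1 hpre⟩

/-- Moves only delete vertices, so all positions reached from the image are images. The ambient
graph `H` may be infinite, so one tree can serve all stars. -/
theorem grundy_map {G : SimpleGraph V} {H : SimpleGraph V'} (φ : G ↪g H) (W : Finset V) :
    grundy (OctalMove H) (W.map φ.toEmbedding) = grundy (OctalMove G) W := by
  induction W using (OctalMove.isWellFounded G).wf.induction with
  | _ W ih =>
    obtain ⟨h1, h2⟩ := grundy_spec (OctalMove.finite G) W
    refine grundy_eq_of (fun Y hY => ?_) (fun u hu => ?_)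
    · obtain ⟨W', -, rfl⟩ := Finset.subset_map_iff.1 hY.subset
      have hm := (octalMove_map φ).1 hY
      rw [ih _ hm]
      exact h1 _ hm
    · obtain ⟨W', hm, rfl⟩ := h2 u hu
      exact ⟨_, (octalMove_map φ).2 hm, ih _ hm⟩

end OctalMove

/-! ### The game on a rooted forest -/

section Forest

variable {V : Type*} (par : V → Option V)

/-- The graph of the forest in which `par` is the parent function. -/
def forestGraph : SimpleGraph V := SimpleGraph.fromRel fun u v => par u = some v

/-- `u` has no parent in `W`. -/
def Orphan (W : Finset V) (u : V) : Prop := ∀ p, par u = some p → p ∉ W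

/-- At most one vertex of `W` has no parent in `W`. -/
def RootUnique (W : Finset V) : Prop :=
  ∀ u ∈ W, ∀ v ∈ W, Orphan par W u → Orphan par W v → u = v

variable {par} {depth : V → ℕ}

theorem forestGraph_adj (hd : ∀ u v, par u = some v → depth v < depth u) {u v : V} :
    (forestGraph par).Adj u v ↔ par u = some v ∨ par v = some u := by
  rw [forestGraph, SimpleGraph.fromRel_adj]
  refine ⟨And.right, fun h => ⟨?_, h⟩⟩
  rintro rfl
  rcases h with h | h <;> exact lt_irrefl _ (hd _ _ h)

theorem reachable_orphan (hd : ∀ u v, par u = some v → depth v < depth u)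
    (W : Finset V) (u : (W : Set V)) :
    ∃ r : (W : Set V), Orphan par W r ∧
      ((forestGraph par).induce (W : Set V)).Reachable u r := by
  induction h : depth u using Nat.strong_induction_on generalizing u with
  | _ n ih =>
    by_cases ho : Orphan par W u
    · exact ⟨u, ho, .refl _⟩
    · simp only [Orphan, not_forall, not_not] at ho
      obtain ⟨p, hp, hpW⟩ := ho
      obtain ⟨r, hr, hpr⟩ := ih _ (h ▸ hd _ _ hp) ⟨p, hpW⟩ rfl
      refine ⟨r, hr, .trans (SimpleGraph.Adj.reachable ?_) hpr⟩
      simpa using (forestGraph_adj hd).2 (.inl hp)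

/-- Climbing to parents inside `W` must stop, so every component contains an orphan; and it contains
only one, because an orphan is an ancestor within `W` of everything it can reach. -/
theorem preconnected_iff_rootUnique (hd : ∀ u v, par u = some v → depth v < depth u)
    (W : Finset V) :
    ((forestGraph par).induce (W : Set V)).Preconnected ↔ RootUnique par W := by
  constructor
  · intro h u hu v hv hou hov
    have key : ∀ x : (W : Set V),
        ((forestGraph par).induce (W : Set V)).Reachable ⟨u, hu⟩ x →
        Relation.ReflTransGen (fun x y => par x = some y ∧ y ∈ W) x u := by
      intro x hx
      rw [SimpleGraph.reachable_iff_reflTransGen] at hx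
      induction hx with
      | refl => exact .refl
      | @tail x y _ hxy ih =>
        -- An edge down to a child extends the chain of ancestors; an edge up to the parent removes
        -- its first link, which exists because the orphan `u` has no parent in `W`.
        have hxy : (forestGraph par).Adj x y := by simpa using hxy
        rcases (forestGraph_adj hd).1 hxy with e | e
        · rcases ih.cases_head with e' | ⟨z, ⟨hz, -⟩, hzu⟩
          · exact absurd y.2 (hou _ (e' ▸ e))
          · rw [e] at hz
            cases hz
            exact hzu
        · exact .head ⟨e, x.2⟩ ih
    rcases (key ⟨v, hv⟩ (h _ _)).cases_head with e | ⟨z, ⟨hz, hzW⟩, -⟩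
    · exact e.symm
    · exact absurd hzW (hov _ hz)
  · intro h u v
    obtain ⟨r, hr, hur⟩ := reachable_orphan hd W u
    obtain ⟨r', hr', hvr⟩ := reachable_orphan hd W v
    obtain rfl : r = r' := Subtype.ext (h _ r.2 _ r'.2 hr hr')
    exact hur.trans hvr.symm

variable [DecidableEq V]

theorem octalMove_forest_iff (hd : ∀ u v, par u = some v → depth v < depth u)
    {W' W : Finset V} :
    OctalMove (forestGraph par) W' W ↔
      (∃ x ∈ W, W' = W.erase x ∨ ∃ p ∈ W, par x = some p ∧ W' = (W.erase x).erase p) ∧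
        RootUnique par W' := by
  constructor
  · rintro ⟨X, hXW, hX, hconn, rfl, hpre⟩
    refine ⟨?_, (preconnected_iff_rootUnique hd _).1 hpre⟩
    rcases hX with hX | hX
    · obtain ⟨x, rfl⟩ := Finset.card_eq_one.1 hX
      exact ⟨x, by simpa using hXW, .inl (by simp [Finset.erase_eq])⟩
    · obtain ⟨x, y, hxy, rfl⟩ := Finset.card_eq_two.1 hX
      have hx : x ∈ W := hXW (by simp)
      have hy : y ∈ W := hXW (by simp)
      have hr := (preconnected_iff_rootUnique hd _).1 hconn.preconnected
      by_cases h1 : par x = some y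
      · exact ⟨x, hx, .inr ⟨y, hy, h1, by ext; simp; tauto⟩⟩
      by_cases h2 : par y = some x
      · exact ⟨y, hy, .inr ⟨x, hx, h2, by ext; simp; tauto⟩⟩
      refine absurd (hr x (by simp) y (by simp) ?_ ?_) hxy
      · intro p hp hpX
        simp only [Finset.mem_insert, Finset.mem_singleton] at hpX
        rcases hpX with rfl | rfl
        · exact lt_irrefl _ (hd _ _ hp)
        · exact h1 hp
      · intro p hp hpX
        simp only [Finset.mem_insert, Finset.mem_singleton] at hpX
        rcases hpX with rfl | rfl
        · exact h2 hp
        · exact lt_irrefl _ (hd _ _ hp)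
  · rintro ⟨⟨x, hx, rfl | ⟨p, hp, hxp, rfl⟩⟩, hr⟩
    · refine ⟨{x}, by simpa using hx, .inl (by simp), ?_, by simp [Finset.erase_eq],
        (preconnected_iff_rootUnique hd _).2 hr⟩
      rw [SimpleGraph.connected_iff]
      refine ⟨(preconnected_iff_rootUnique hd _).2 ?_, by simp⟩
      intro u hu v hv _ _
      simp_all
    · have hne : x ≠ p := by
        rintro rfl
        exact lt_irrefl _ (hd _ _ hxp)
      refine ⟨{x, p}, ?_, .inr (Finset.card_pair hne), ?_, by ext; simp; tauto,
        (preconnected_iff_rootUnique hd _).2 hr⟩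
      · intro z hz
        simp only [Finset.mem_insert, Finset.mem_singleton] at hz
        rcases hz with rfl | rfl <;> assumption
      · rw [SimpleGraph.connected_iff]
        refine ⟨(preconnected_iff_rootUnique hd _).2 ?_, by simp⟩
        have h1 : ∀ u ∈ ({x, p} : Finset V), Orphan par {x, p} u → u = p := by
          intro u hu ho
          simp only [Finset.mem_insert, Finset.mem_singleton] at hu
          rcases hu with rfl | rfl
          · exact absurd (by simp) (ho p hxp)
          · rfl
        intro u hu v hv hou hov
        rw [h1 u hu hou, h1 v hv hov]

end Forest

/-! ### The ten classes in terms of residues -/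

namespace StarClass

/-- The common Grundy value of the stars of a class. -/
def val : StarClass → ℕ
  | d0 | d0s => 0
  | d1 | d1s | d1b => 1
  | d2 | d2s | d2b => 2
  | d3 | d3b => 3

/-- The Grundy value of a bistar whose two stars belong to the given classes. -/
def val₂ (c c' : StarClass) : ℕ := table c c' c.val c'.val

theorem val₂_comm (c c' : StarClass) : val₂ c c' = val₂ c' c := by
  cases c <;> cases c' <;> rfl

/-- Joining `P_2` through the middle vertex adds a path of length 3, invisible modulo 3. This lets a
lone star, left after removal of the middle vertex, be treated as a bistar with one side of class
`d2s`. -/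
theorem val₂_d2s (c : StarClass) : val₂ d2s c = c.val := by
  cases c <;> rfl

/-- The class of a star with `a` paths of length 1 and `b` paths of length 2 modulo 3. -/
def ofCounts : ℕ → ℕ → StarClass
  | 0, 0 => d1s
  | 1, 0 => d2s
  | 0, 1 => d0s
  | 1, 1 => d1s
  | 0, 2 => d2s
  | 0, 3 => d1s
  | a, 0 => if a % 2 = 0 then d0s else d1b
  | a, 1 => if a % 2 = 0 then d2b else d3b
  | a, 2 => if a % 2 = 0 then d1b else d0s
  | a, 3 => if a % 2 = 0 then d3b else d2b
  | a, b => if b % 2 = 0 then (if a % 2 = 0 then d0 else d1) else (if a % 2 = 0 then d2 else d3)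

theorem ofCounts_add_two_left (a b : ℕ) : ofCounts (a + 2 + 2) b = ofCounts (a + 2) b := by
  rcases b with _ | _ | _ | _ | b <;> simp [ofCounts]

theorem ofCounts_add_two_right (a b : ℕ) : ofCounts a (b + 4 + 2) = ofCounts a (b + 4) := by
  rcases a with _ | _ | a <;> simp [ofCounts]

/-- A property of a pair of numbers that is eventually periodic of period 2 in both arguments. -/
theorem forall_of_periodic {P : ℕ → ℕ → Prop} (ha : ∀ a b, P (a + 3) b → P (a + 5) b)
    (hb : ∀ a b, P a (b + 5) → P a (b + 7)) (h : ∀ a < 5, ∀ b < 7, P a b) (a b : ℕ) : P a b := by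
  have h1 : ∀ b, ∀ a < 5, P a b := by
    intro b
    induction b using Nat.strong_induction_on with
    | _ b ih =>
      intro a ha
      by_cases hb7 : b < 7
      · exact h a ha b hb7
      · obtain ⟨b, rfl⟩ := Nat.exists_eq_add_of_le' (not_lt.1 hb7)
        exact hb _ _ (ih _ (by omega) _ ha)
  induction a using Nat.strong_induction_on with
  | _ a ih =>
    by_cases ha5 : a < 5
    · exact h1 b a ha5
    · obtain ⟨a, rfl⟩ := Nat.exists_eq_add_of_le' (not_lt.1 ha5)
      exact ha _ _ (ih _ (by omega))

/-- The class after replacing the numbers `a`, `b` by those obtained by adding a path of length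
`r` modulo 3. -/
def joinPath (a b : ℕ) : ℕ → StarClass
  | 1 => ofCounts (a + 1) b
  | 2 => ofCounts a (b + 1)
  | _ => ofCounts a b

theorem joinPath_add_two_left (a b r : ℕ) : joinPath (a + 2 + 2) b r = joinPath (a + 2) b r := by
  unfold joinPath
  split
  · exact ofCounts_add_two_left (a + 1) b
  · exact ofCounts_add_two_left a (b + 1)
  · exact ofCounts_add_two_left a b

theorem joinPath_add_two_right (a b r : ℕ) : joinPath a (b + 4 + 2) r = joinPath a (b + 4) r := by
  unfold joinPath
  split
  · exact ofCounts_add_two_right (a + 1) b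
  · exact ofCounts_add_two_right a (b + 1)
  · exact ofCounts_add_two_right a b

/-- Periodicity reduces this to a finite check. It is the reason that no move that shortens a path
preserves the predicted value. -/
theorem val₂_joinPath_pairwise_ne (a b : ℕ) (c : StarClass) :
    val₂ (joinPath a b 0) c ≠ val₂ (joinPath a b 1) c ∧
      val₂ (joinPath a b 0) c ≠ val₂ (joinPath a b 2) c ∧
        val₂ (joinPath a b 1) c ≠ val₂ (joinPath a b 2) c := by
  revert a b
  refine forall_of_periodic ?_ ?_ ?_
  · intro a b h
    simpa only [joinPath_add_two_left (a + 1)] using h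
  · intro a b h
    simpa only [joinPath_add_two_right a (b + 1)] using h
  · cases c <;> decide

theorem val₂_joinPath_ne (a b : ℕ) (c : StarClass) {r r' : ℕ} (hr : r < 3) (hr' : r' < 3)
    (h : r ≠ r') : val₂ (joinPath a b r) c ≠ val₂ (joinPath a b r') c := by
  obtain ⟨h1, h2, h3⟩ := val₂_joinPath_pairwise_ne a b c
  interval_cases r <;> interval_cases r' <;>
    first | exact absurd rfl h | assumption | (symm; assumption)

theorem val_joinPath_ne (a b : ℕ) {r r' : ℕ} (hr : r < 3) (hr' : r' < 3) (h : r ≠ r') :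
    (joinPath a b r).val ≠ (joinPath a b r').val := by
  rw [← val₂_d2s, ← val₂_d2s, val₂_comm d2s, val₂_comm d2s]
  exact val₂_joinPath_ne a b d2s hr hr' h

/-- The classes reached from `a`, `b` by shortening a path by 1 or 2 vertices within its residue
range. -/
inductive LegOption : ℕ → ℕ → StarClass → Prop
  | one (a b : ℕ) : LegOption (a + 1) b (ofCounts a b)
  | two (a b : ℕ) : LegOption a (b + 1) (ofCounts a b)
  | two_one (a b : ℕ) : LegOption a (b + 1) (ofCounts (a + 1) b)

/-- The threshold is 3 because an option may lower the count by one, and `ofCounts` is periodic from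
2 on. -/
theorem LegOption.add_two_left {a b : ℕ} {c : StarClass} (h : LegOption (a + 3) b c) :
    LegOption (a + 5) b c := by
  cases h
  · rw [← ofCounts_add_two_left]
    exact .one _ _
  · rw [← ofCounts_add_two_left (a + 1)]
    exact .two _ _
  · rw [← ofCounts_add_two_left (a + 2)]
    exact .two_one _ _

theorem LegOption.add_two_right {a b : ℕ} {c : StarClass} (h : LegOption a (b + 5) c) :
    LegOption a (b + 7) c := by
  cases h
  · rw [← ofCounts_add_two_right _ (b + 1)]
    exact .one _ _
  · rw [← ofCounts_add_two_right]
    exact .two _ _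
  · rw [← ofCounts_add_two_right]
    exact .two_one _ _

/-- The classes together with classes of options that suffice to determine the Grundy values. -/
def kinds : List (StarClass × List StarClass) :=
  [(d0, []), (d0s, [d1b]), (d0s, [d2s]), (d1, [d0]), (d1b, [d0s]), (d1s, [d0s, d2s]),
    (d2, [d0, d1]), (d2b, [d0s, d1b, d1s]), (d2b, [d0s, d1b, d3b]), (d2s, [d0s, d1s]),
    (d3, [d0, d1, d2]), (d3b, [d0s, d1b, d2b])]

/-- The excluded pairs are `(0, 0)` and `(1, 0)`: there some needed options come from long paths of
other residues or from deleting a centre. They are treated in `exists_kind_of_side`. -/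
theorem exists_kind (a b : ℕ) (h : b = 0 → 2 ≤ a) :
    ∃ k ∈ kinds, k.1 = ofCounts a b ∧ ∀ d ∈ k.2, LegOption a b d := by
  revert h
  revert a b
  refine forall_of_periodic ?_ ?_ ?_
  · intro a b h _
    obtain ⟨k, hk, e, ho⟩ := h (by omega)
    exact ⟨k, hk, by rw [e, ← ofCounts_add_two_left (a + 1)], fun d hd => (ho d hd).add_two_left⟩
  · intro a b h _
    obtain ⟨k, hk, e, ho⟩ := h (by omega)
    exact ⟨k, hk, by rw [e, ← ofCounts_add_two_right a (b + 1)],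
      fun d hd => (ho d hd).add_two_right⟩
  · intro a ha b hb h
    have key : ∀ k ∈ kinds, k.1 = ofCounts a b → (∀ d ∈ k.2, LegOption a b d) →
        ∃ k ∈ kinds, k.1 = ofCounts a b ∧ ∀ d ∈ k.2, LegOption a b d :=
      fun k hk e ho => ⟨k, hk, e, ho⟩
    simp only [kinds, List.forall_mem_cons, List.not_mem_nil, false_imp_iff, implies_true,
      and_true] at key
    obtain ⟨k1, k2, k3, k4, k5, k6, k7, k8, k9, k10, k11, k12⟩ := key
    -- Each alternative proposes a kind and a way of producing its options; `rfl` rejects the wrong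
    -- class.
    interval_cases a <;> interval_cases b <;> first
      | omega
      | exact k1 rfl trivial
      | exact k2 rfl (.one _ _)
      | exact k3 rfl (.one _ _)
      | exact k3 rfl (.two_one _ _)
      | exact k3 rfl (.two _ _)
      | exact k4 rfl (.one _ _)
      | exact k5 rfl (.one _ _)
      | exact k6 rfl ⟨.one _ _, .two_one _ _⟩
      | exact k6 rfl ⟨.two_one _ _, .two _ _⟩
      | exact k7 rfl ⟨.two _ _, .two_one _ _⟩
      | exact k8 rfl ⟨.two _ _, .two_one _ _, .one _ _⟩
      | exact k8 rfl ⟨.two_one _ _, .two _ _, .one _ _⟩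
      | exact k9 rfl ⟨.two _ _, .two_one _ _, .one _ _⟩
      | exact k9 rfl ⟨.two_one _ _, .two _ _, .one _ _⟩
      | exact k10 rfl ⟨.two _ _, .two_one _ _⟩
      | exact k11 rfl ⟨.two_one _ _, .two _ _, .one _ _⟩
      | exact k12 rfl ⟨.two_one _ _, .two _ _, .one _ _⟩

theorem exists_of_lt_val {k : StarClass × List StarClass} (hk : k ∈ kinds) :
    ∀ u < k.1.val, ∃ d ∈ k.2, d.val = u := by
  revert k
  decide

/-- A finite check over pairs of kinds: the listed options on the two sides already attain every
value below the table entry. -/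
theorem exists_of_lt_val₂ {k k' : StarClass × List StarClass} (hk : k ∈ kinds) (hk' : k' ∈ kinds) :
    ∀ u < val₂ k.1 k'.1, (∃ d ∈ k.2, val₂ d k'.1 = u) ∨ ∃ d ∈ k'.2, val₂ k.1 d = u := by
  revert k'
  revert k
  decide

end StarClass

/-! ### Paths attached to two centres -/

section Counts

variable {I : Type*} [Fintype I] (σ : I → Bool)

/-- The number of paths on side `s` whose length is `r` modulo 3. -/
def pathCount (f : I → ℕ) (s : Bool) (r : ℕ) : ℕ :=
  (Finset.univ.filter fun i => σ i = s ∧ f i % 3 = r).card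

/-- The class of the star on side `s`. -/
def sideClass (f : I → ℕ) (s : Bool) : StarClass :=
  StarClass.ofCounts (pathCount σ f s 1) (pathCount σ f s 2)

/-- The class of the possibly empty star on side `s`. -/
def starClass (c : Bool → Bool) (f : I → ℕ) (s : Bool) : StarClass :=
  if c s = true then sideClass σ f s else .d0s

variable {σ}

theorem starClass_of_present {c : Bool → Bool} {s : Bool} (hs : c s = true) (f : I → ℕ) :
    starClass σ c f s = sideClass σ f s :=
  if_pos hs

theorem starClass_of_absent {c : Bool → Bool} {s : Bool} (hs : c s = false) (f : I → ℕ) :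
    starClass σ c f s = .d0s :=
  if_neg (by simp [hs])

theorem pathCount_congr {f f' : I → ℕ} {s : Bool} (h : ∀ i, σ i = s → f i = f' i) (r : ℕ) :
    pathCount σ f s r = pathCount σ f' s r := by
  unfold pathCount
  congr 1
  ext i
  by_cases hi : σ i = s <;> simp [hi, h]

theorem sideClass_congr {f f' : I → ℕ} {s : Bool} (h : ∀ i, σ i = s → f i = f' i) :
    sideClass σ f s = sideClass σ f' s := by
  rw [sideClass, sideClass, pathCount_congr h, pathCount_congr h]

theorem pathCount_eq_zero_iff {f : I → ℕ} {s : Bool} {r : ℕ} :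
    pathCount σ f s r = 0 ↔ ∀ i, σ i = s → f i % 3 ≠ r := by
  simp [pathCount, Finset.filter_eq_empty_iff]

theorem pathCount_eq_zero {f : I → ℕ} {s : Bool} (h : ∀ i, σ i = s → f i = 0) {r : ℕ}
    (hr : r ≠ 0) : pathCount σ f s r = 0 :=
  pathCount_eq_zero_iff.2 fun i hi => by simp [h i hi, hr.symm]

theorem sideClass_of_zero {f : I → ℕ} {s : Bool} (h : ∀ i, σ i = s → f i = 0) :
    sideClass σ f s = .d1s := by
  rw [sideClass, pathCount_eq_zero h one_ne_zero, pathCount_eq_zero h two_ne_zero]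
  rfl

theorem exists_of_pathCount {f : I → ℕ} {s : Bool} {r : ℕ} (h : pathCount σ f s r ≠ 0) :
    ∃ i, σ i = s ∧ f i % 3 = r := by
  by_contra! hc
  exact h (pathCount_eq_zero_iff.2 hc)

theorem val₂_starClass (c : Bool → Bool) (f : I → ℕ) (s : Bool) :
    StarClass.val₂ (starClass σ c f false) (starClass σ c f true) =
      StarClass.val₂ (starClass σ c f s) (starClass σ c f !s) := by
  cases s
  · rfl
  · exact StarClass.val₂_comm _ _

theorem starClass_remove (c : Bool → Bool) (f : I → ℕ) (s : Bool) :
    starClass σ (Function.update c s false) f s = .d0s := by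
  simp [starClass]

theorem starClass_remove_not (c : Bool → Bool) {f f' : I → ℕ} {s : Bool}
    (h : ∀ i, σ i = (!s) → f i = f' i) :
    starClass σ (Function.update c s false) f (!s) = starClass σ c f' !s := by
  simp [starClass, sideClass_congr h]

variable [DecidableEq I]

theorem pathCount_update (f : I → ℕ) (i : I) (n : ℕ) (s : Bool) {r : ℕ} (hr : r ≠ 0) :
    pathCount σ (Function.update f i n) s r =
      pathCount σ (Function.update f i 0) s r + if σ i = s ∧ n % 3 = r then 1 else 0 := by
  unfold pathCount
  split_ifs with h
  · rw [← Finset.card_insert_of_notMem (a := i)]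
    · congr 1
      ext x
      by_cases hx : x = i <;> simp [hx, h]
    · simp [hr.symm]
  · rw [add_zero]
    congr 1
    ext x
    by_cases hx : x = i
    · subst hx
      simp [h, hr.symm]
    · simp [hx]

/-- Isolating path `i`, with the counts of the other paths fixed, exhibits the classes before and
after a move as `joinPath` of the same pair at two residues. -/
theorem sideClass_update (f : I → ℕ) (i : I) (n : ℕ) :
    sideClass σ (Function.update f i n) (σ i) =
      StarClass.joinPath (pathCount σ (Function.update f i 0) (σ i) 1)
        (pathCount σ (Function.update f i 0) (σ i) 2) (n % 3) := by
  have h3 : n % 3 < 3 := Nat.mod_lt _ (by norm_num)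
  rw [sideClass, pathCount_update f i n (σ i) one_ne_zero, pathCount_update f i n _ two_ne_zero]
  interval_cases n % 3 <;> simp [StarClass.joinPath]

theorem sideClass_eq_joinPath (f : I → ℕ) (i : I) :
    sideClass σ f (σ i) =
      StarClass.joinPath (pathCount σ (Function.update f i 0) (σ i) 1)
        (pathCount σ (Function.update f i 0) (σ i) 2) (f i % 3) := by
  have := sideClass_update (σ := σ) f i (f i)
  rwa [Function.update_eq_self] at this

theorem sideClass_update_of_ne (f : I → ℕ) {i : I} (n : ℕ) {s : Bool} (h : σ i ≠ s) :
    sideClass σ (Function.update f i n) s = sideClass σ f s :=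
  sideClass_congr fun j hj => by
    rw [Function.update_of_ne]
    rintro rfl
    exact h hj

theorem sideClass_of_single {f : I → ℕ} {i : I}
    (h : ∀ j, j ≠ i → σ j = σ i → f j = 0) :
    sideClass σ f (σ i) = StarClass.joinPath 0 0 (f i % 3) := by
  have h' : ∀ j, σ j = σ i → Function.update f i 0 j = 0 := by
    intro j hj
    by_cases e : j = i
    · simp [e]
    · simpa [e] using h j e hj
  rw [sideClass_eq_joinPath, pathCount_eq_zero h' one_ne_zero, pathCount_eq_zero h' two_ne_zero]

theorem sideClass_of_pair {f : I → ℕ} {i i' : I} (hne : i ≠ i') (hi : σ i' = σ i) (h1 : f i' = 1)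
    (h : ∀ j, j ≠ i → j ≠ i' → σ j = σ i → f j = 0) :
    sideClass σ f (σ i) = StarClass.joinPath 1 0 (f i % 3) := by
  have h' : ∀ j, σ j = σ i → Function.update (Function.update f i 0) i' 0 j = 0 := by
    intro j hj
    by_cases e' : j = i'
    · simp [e']
    by_cases e : j = i
    · simp [e, hne]
    · simpa [e, e'] using h j e e' hj
  have e : Function.update (Function.update f i 0) i' 1 = Function.update f i 0 := by
    rw [Function.update_eq_self_iff]
    simp [hne.symm, h1]
  have h2 := pathCount_update (σ := σ) (Function.update f i 0) i' 1 (σ i) one_ne_zero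
  have h3 := pathCount_update (σ := σ) (Function.update f i 0) i' 1 (σ i) two_ne_zero
  rw [e, pathCount_eq_zero h' one_ne_zero] at h2
  rw [e, pathCount_eq_zero h' two_ne_zero] at h3
  rw [sideClass_eq_joinPath, h2, h3]
  simp [hi]

theorem sideClass_update_eq {f : I → ℕ} {i : I} {n a b a' b' : ℕ}
    (ha : pathCount σ f (σ i) 1 = a) (hb : pathCount σ f (σ i) 2 = b)
    (ha' : a' + (if f i % 3 = 1 then 1 else 0) = a + if n % 3 = 1 then 1 else 0)
    (hb' : b' + (if f i % 3 = 2 then 1 else 0) = b + if n % 3 = 2 then 1 else 0) :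
    sideClass σ (Function.update f i n) (σ i) = StarClass.ofCounts a' b' := by
  have h1 := pathCount_update (σ := σ) f i n (σ i) one_ne_zero
  have h2 := pathCount_update (σ := σ) f i n (σ i) two_ne_zero
  have h3 := pathCount_update (σ := σ) f i (f i) (σ i) one_ne_zero
  have h4 := pathCount_update (σ := σ) f i (f i) (σ i) two_ne_zero
  rw [Function.update_eq_self] at h3 h4
  simp only [true_and] at h1 h2 h3 h4
  rw [sideClass]
  congr 1 <;> omega

/-- `n` is the length of a path after a move on a path of length `l`. -/
def Shortens (n l : ℕ) : Prop := n + 1 = l ∨ n + 2 = l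

theorem Shortens.mod_ne {n l : ℕ} (h : Shortens n l) : n % 3 ≠ l % 3 := by
  unfold Shortens at h
  omega

theorem exists_shortens_of_legOption {f : I → ℕ} {s : Bool} {d : StarClass}
    (h : StarClass.LegOption (pathCount σ f s 1) (pathCount σ f s 2) d) :
    ∃ i n, σ i = s ∧ Shortens n (f i) ∧ sideClass σ (Function.update f i n) s = d := by
  generalize ha : pathCount σ f s 1 = a at h
  generalize hb : pathCount σ f s 2 = b at h
  cases h with
  | one a b =>
    obtain ⟨i, rfl, hi⟩ := exists_of_pathCount (σ := σ) (f := f) (s := s) (r := 1) (by omega)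
    refine ⟨i, f i - 1, rfl, .inl (by omega), sideClass_update_eq ha hb ?_ ?_⟩
    all_goals split_ifs <;> omega
  | two a b =>
    obtain ⟨i, rfl, hi⟩ := exists_of_pathCount (σ := σ) (f := f) (s := s) (r := 2) (by omega)
    refine ⟨i, f i - 2, rfl, .inr (by omega), sideClass_update_eq ha hb ?_ ?_⟩
    all_goals split_ifs <;> omega
  | two_one a b =>
    obtain ⟨i, rfl, hi⟩ := exists_of_pathCount (σ := σ) (f := f) (s := s) (r := 2) (by omega)
    refine ⟨i, f i - 1, rfl, .inl (by omega), sideClass_update_eq ha hb ?_ ?_⟩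
    all_goals split_ifs <;> omega

/-- On one side, the options of a kind are reached by shortening a path, unless the star has only
one or two vertices. -/
theorem exists_kind_of_side (f : I → ℕ) (s : Bool) :
    ∃ k ∈ StarClass.kinds, k.1 = sideClass σ f s ∧ ∀ d ∈ k.2,
      (∃ i n, σ i = s ∧ Shortens n (f i) ∧ sideClass σ (Function.update f i n) s = d) ∨
      ((∀ i, σ i = s → f i = 0) ∧ (d = .d0s ∨ d = .d2s)) ∨
      (∃ i, σ i = s ∧ f i = 1 ∧ (∀ j, j ≠ i → σ j = s → f j = 0) ∧ d = .d0s) := by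
  -- A path of residue 1 or 2 is long enough to be shortened within that range, so only the counts
  -- `(0, 0)` and `(1, 0)` need care.
  by_cases h : pathCount σ f s 2 = 0 → 2 ≤ pathCount σ f s 1
  · obtain ⟨k, hk, e, ho⟩ := StarClass.exists_kind _ _ h
    exact ⟨k, hk, e, fun d hd => .inl (exists_shortens_of_legOption (ho d hd))⟩
  obtain ⟨hb, ha⟩ : pathCount σ f s 2 = 0 ∧ pathCount σ f s 1 < 2 := by
    by_contra hc
    exact h fun h0 => not_lt.1 fun h1 => hc ⟨h0, h1⟩
  generalize ha' : pathCount σ f s 1 = a at ha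
  have hb2 := pathCount_eq_zero_iff.1 hb
  interval_cases a
  · have ha1 := pathCount_eq_zero_iff.1 ha'
    refine ⟨(.d1s, [.d0s, .d2s]), by simp [StarClass.kinds], by rw [sideClass, ha', hb]; rfl, ?_⟩
    by_cases hz : ∀ i, σ i = s → f i = 0
    · intro d hd
      exact .inr (.inl ⟨hz, by simpa using hd⟩)
    push Not at hz
    obtain ⟨i, rfl, hi⟩ := hz
    have h1 := ha1 i rfl
    have h2 := hb2 i rfl
    simp only [List.forall_mem_cons, List.not_mem_nil, false_imp_iff, implies_true, and_true]
    -- Path `i` has a positive length divisible by 3, so both shortenings are possible and give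
    -- residues 2 and 1.
    refine ⟨.inl ⟨i, f i - 1, rfl, .inl (by omega), ?_⟩,
      .inl ⟨i, f i - 2, rfl, .inr (by omega), ?_⟩⟩
    · refine sideClass_update_eq (a' := 0) (b' := 1) ha' hb ?_ ?_ <;> split_ifs <;> omega
    · refine sideClass_update_eq (a' := 1) (b' := 0) ha' hb ?_ ?_ <;> split_ifs <;> omega
  · obtain ⟨i, rfl, hi⟩ := exists_of_pathCount (σ := σ) (f := f) (s := s) (r := 1) (by omega)
    refine ⟨(.d2s, [.d0s, .d1s]), by simp [StarClass.kinds], by rw [sideClass, ha', hb]; rfl, ?_⟩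
    simp only [List.forall_mem_cons, List.not_mem_nil, false_imp_iff, implies_true, and_true]
    constructor
    · by_cases hi1 : f i = 1
      · by_cases hz : ∀ j, j ≠ i → σ j = σ i → f j = 0
        · exact .inr (.inr ⟨i, rfl, hi1, hz⟩)
        · push Not at hz
          obtain ⟨j, hji, hj, hj0⟩ := hz
          have h2 := hb2 j hj
          -- A second path of residue 1 would bring the count to 2; hence the length of path `j` is
          -- a positive multiple of 3.
          have h1 : f j % 3 ≠ 1 := by
            intro h1
            have : ({i, j} : Finset I) ⊆ Finset.univ.filter fun x => σ x = σ i ∧ f x % 3 = 1 := by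
              intro x hx
              simp only [Finset.mem_insert, Finset.mem_singleton] at hx
              rcases hx with rfl | rfl <;> simp [*]
            have := Finset.card_le_card this
            rw [Finset.card_pair hji.symm] at this
            rw [pathCount] at ha'
            omega
          rw [← hj] at ha' hb ⊢
          -- The counts become `(2, 0)`, which is also of class `d0s`.
          refine .inl ⟨j, f j - 2, rfl, .inr (by omega), ?_⟩
          refine sideClass_update_eq (a' := 2) (b' := 0) ha' hb ?_ ?_ <;> split_ifs <;> omega
      · refine .inl ⟨i, f i - 2, rfl, .inr (by omega), ?_⟩
        refine sideClass_update_eq (a' := 0) (b' := 1) ha' hb ?_ ?_ <;> split_ifs <;> omega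
    · refine .inl ⟨i, f i - 1, rfl, .inl (by omega), ?_⟩
      refine sideClass_update_eq (a' := 0) (b' := 0) ha' hb ?_ ?_ <;> split_ifs <;> omega

end Counts

/-! ### A tree containing all bistars -/

/-- The vertices of a tree that contains all bistars whose paths are indexed by `I`: the middle
vertex, the two centres, and the vertices of the paths, numbered from the centre. -/
inductive BVertex (I : Type*) : Type _
  | mid : BVertex I
  | cen (s : Bool) : BVertex I
  | leg (i : I) (j : ℕ) : BVertex I
  deriving DecidableEq

namespace BVertex

variable {I : Type*}

/-- The parent function of the tree rooted at the middle vertex, if path `i` is on side `σ i`. -/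
def par (σ : I → Bool) : BVertex I → Option (BVertex I)
  | mid => none
  | cen _ => some mid
  | leg i 0 => some (cen (σ i))
  | leg i (j + 1) => some (leg i j)

/-- The distance to the middle vertex. -/
def depth : BVertex I → ℕ
  | mid => 0
  | cen _ => 1
  | leg _ j => j + 2

theorem depth_lt (σ : I → Bool) (u v : BVertex I) (h : par σ u = some v) : depth v < depth u := by
  rcases u with _ | s | ⟨i, _ | j⟩ <;> simp only [par, reduceCtorEq, Option.some.injEq] at h <;>
    subst h <;> simp [depth]

end BVertex

open BVertex

section Moves

variable {I : Type*} {σ : I → Bool}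

/-- `W` consists of the centres given by `c`, of the middle vertex if `m`, and of the paths of
lengths `f`. -/
structure IsShape (W : Finset (BVertex I)) (c : Bool → Bool) (m : Bool) (f : I → ℕ) : Prop where
  mid_mem : mid ∈ W ↔ m = true
  cen_mem : ∀ s, cen s ∈ W ↔ c s = true
  leg_mem : ∀ i j, leg i j ∈ W ↔ j < f i

/-- `W` is the part of path `i` between `lo` and `hi`. -/
def IsSegment (W : Finset (BVertex I)) (i : I) (lo hi : ℕ) : Prop :=
  ∀ x, x ∈ W ↔ ∃ j, lo ≤ j ∧ j < hi ∧ x = leg i j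

/-- Paths are attached only to centres that are present. -/
def Attached (σ : I → Bool) (c : Bool → Bool) (f : I → ℕ) : Prop :=
  ∀ i, c (σ i) = false → f i = 0

theorem rootUnique_of_root {V : Type*} {p : V → Option V} {W : Finset V} (r : V)
    (h : ∀ u ∈ W, u ≠ r → ∃ q ∈ W, p u = some q) : RootUnique p W := by
  have h' : ∀ u ∈ W, Orphan p W u → u = r := by
    intro u hu ho
    by_contra hne
    obtain ⟨q, hq, e⟩ := h u hu hne
    exact ho q e hq
  intro u hu v hv hou hov
  rw [h' u hu hou, h' v hv hov]

theorem IsShape.rootUnique_bistar {W : Finset (BVertex I)} {c : Bool → Bool} {f : I → ℕ}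
    (h : IsShape W c true f) (ha : Attached σ c f) : RootUnique (par σ) W := by
  refine rootUnique_of_root mid ?_
  rintro (_ | s | ⟨i, _ | j⟩) hu hne
  · exact absurd rfl hne
  · exact ⟨mid, h.mid_mem.2 rfl, rfl⟩
  · refine ⟨cen (σ i), ?_, rfl⟩
    rw [h.leg_mem] at hu
    rw [h.cen_mem]
    by_contra hc
    have := ha i (by simpa using hc)
    omega
  · refine ⟨leg i j, ?_, rfl⟩
    rw [h.leg_mem] at hu ⊢
    omega

theorem IsShape.rootUnique_star {W : Finset (BVertex I)} {c : Bool → Bool} {f : I → ℕ}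
    (h : IsShape W c false f) (ha : Attached σ c f) {s : Bool} (hs : c (!s) = false) :
    RootUnique (par σ) W := by
  refine rootUnique_of_root (cen s) ?_
  rintro (_ | t | ⟨i, _ | j⟩) hu hne
  · simp [h.mid_mem] at hu
  · obtain rfl : t = !s := by
      cases t <;> cases s <;> simp_all
    simp [h.cen_mem, hs] at hu
  · refine ⟨cen (σ i), ?_, rfl⟩
    rw [h.leg_mem] at hu
    rw [h.cen_mem]
    by_contra hc
    have := ha i (by simpa using hc)
    omega
  · refine ⟨leg i j, ?_, rfl⟩
    rw [h.leg_mem] at hu ⊢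
    omega

theorem isSegment_of {W : Finset (BVertex I)} {i : I} {lo hi : ℕ} (hm : mid ∉ W)
    (hc : ∀ s, cen s ∉ W) (hl : ∀ k j, leg k j ∈ W ↔ k = i ∧ lo ≤ j ∧ j < hi) :
    IsSegment W i lo hi := by
  rintro (_ | s | ⟨k, j⟩)
  · simp [hm]
  · simp [hc]
  · rw [hl]
    constructor
    · rintro ⟨rfl, h1, h2⟩
      exact ⟨j, h1, h2, rfl⟩
    · rintro ⟨j', h1, h2, e⟩
      cases e
      exact ⟨rfl, h1, h2⟩

theorem IsSegment.leg_mem {W : Finset (BVertex I)} {i : I} {lo hi j : ℕ}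
    (h : IsSegment W i lo hi) : leg i j ∈ W ↔ lo ≤ j ∧ j < hi := by
  rw [h]
  constructor
  · rintro ⟨j', h1, h2, e⟩
    cases e
    exact ⟨h1, h2⟩
  · rintro ⟨h1, h2⟩
    exact ⟨j, h1, h2, rfl⟩

theorem IsSegment.orphan {W : Finset (BVertex I)} {i : I} {lo hi j : ℕ}
    (h : IsSegment W i lo hi) {W' : Finset (BVertex I)} (hW' : W' ⊆ W)
    (hj : ∀ l, l + 1 = j → leg i l ∉ W') : Orphan (par σ) W' (leg i j) := by
  intro p hp hpW
  rcases j with _ | j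
  · simp only [par, Option.some.injEq] at hp
    subst hp
    obtain ⟨l, -, -, e⟩ := (h _).1 (hW' hpW)
    simp at e
  · simp only [par, Option.some.injEq] at hp
    subst hp
    exact hj j rfl hpW

theorem Attached.remove {c : Bool → Bool} {f : I → ℕ} (h : Attached σ c f) {s : Bool}
    (hz : ∀ i, σ i = s → f i = 0) : Attached σ (Function.update c s false) f := by
  intro i hi
  by_cases hs : σ i = s
  · exact hz i hs
  · exact h i (by simpa [hs] using hi)

theorem IsSegment.rootUnique {W : Finset (BVertex I)} {i : I} {lo hi : ℕ}
    (h : IsSegment W i lo hi) : RootUnique (par σ) W := by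
  refine rootUnique_of_root (leg i lo) fun u hu hne => ?_
  obtain ⟨j, h1, h2, rfl⟩ := (h u).1 hu
  have hj : j ≠ lo := by rintro rfl; exact hne rfl
  obtain ⟨j, rfl⟩ := Nat.exists_eq_add_of_lt (lt_of_le_of_ne h1 hj.symm)
  exact ⟨leg i (lo + j), h.leg_mem.2 ⟨by omega, by omega⟩, rfl⟩

variable [DecidableEq I]

variable (σ) in
/-- The game on the tree. -/
abbrev TreeMove (W' W : Finset (BVertex I)) : Prop := OctalMove (forestGraph (par σ)) W' W

theorem treeMove_iff {W' W : Finset (BVertex I)} :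
    TreeMove σ W' W ↔
      (∃ x ∈ W, W' = W.erase x ∨ ∃ p ∈ W, par σ x = some p ∧ W' = (W.erase x).erase p) ∧
        RootUnique (par σ) W' :=
  octalMove_forest_iff (depth_lt σ)

/-- Shortening a path, as a removal of vertices. -/
theorem IsShape.exists_shorten {W : Finset (BVertex I)} {c : Bool → Bool} {m : Bool} {f : I → ℕ}
    (h : IsShape W c m f) {i : I} {n : ℕ} (hn : Shortens n (f i)) :
    ∃ W', IsShape W' c m (Function.update f i n) ∧ (RootUnique (par σ) W' → TreeMove σ W' W) := by
  rcases hn with hn | hn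
  · refine ⟨W.erase (leg i n), ⟨by simp [h.mid_mem], by simp [h.cen_mem], fun i' j => ?_⟩,
      fun hr => treeMove_iff.2 ⟨⟨leg i n, (h.leg_mem _ _).2 (by omega), .inl rfl⟩, hr⟩⟩
    by_cases e : i' = i
    · subst e
      simp [h.leg_mem]
      omega
    · simp [h.leg_mem, e]
  · refine ⟨(W.erase (leg i (n + 1))).erase (leg i n),
      ⟨by simp [h.mid_mem], by simp [h.cen_mem], fun i' j => ?_⟩,
      fun hr => treeMove_iff.2 ⟨⟨leg i (n + 1), (h.leg_mem _ _).2 (by omega),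
        .inr ⟨leg i n, (h.leg_mem _ _).2 (by omega), rfl, rfl⟩⟩, hr⟩⟩
    by_cases e : i' = i
    · subst e
      simp [h.leg_mem]
      omega
    · simp [h.leg_mem, e]

/-- Removing only vertices of a path while an orphan outside the paths remains amounts to shortening
the path. -/
theorem IsShape.shorten_of_erase {W : Finset (BVertex I)} {c : Bool → Bool} {m : Bool} {f : I → ℕ}
    (h : IsShape W c m f) {r : BVertex I} (hr : r ∈ W) (hr' : ∀ i j, r ≠ leg i j)
    {i : I} {j k : ℕ} (hjk : k = j ∨ k = j + 1) (hk : k < f i) {W' : Finset (BVertex I)}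
    (hW' : W' = (W.erase (leg i k)).erase (leg i j)) (ho : Orphan (par σ) W r)
    (hu : RootUnique (par σ) W') :
    ∃ n, Shortens n (f i) ∧ IsShape W' c m (Function.update f i n) := by
  have hrW' : r ∈ W' := by simp [hW', hr, hr']
  -- Otherwise the next vertex of the path would survive as a second orphan beside `r`; so the
  -- deletion is at the far end.
  have hkf : k + 1 = f i := by
    by_contra hne
    refine hr' i (k + 1) (hu r hrW' (leg i (k + 1)) ?_ ?_ ?_)
    · simp only [hW', Finset.mem_erase, h.leg_mem]
      exact ⟨by simp; omega, by simp, by omega⟩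
    · intro p hp hpW
      exact ho p hp (by simp only [hW', Finset.mem_erase] at hpW; exact hpW.2.2)
    · intro p hp hpW
      simp only [par, Option.some.injEq] at hp
      subst hp
      simp [hW'] at hpW
  refine ⟨j, by unfold Shortens; omega, ?_, ?_, ?_⟩
  · simp [hW', h.mid_mem]
  · simp [hW', h.cen_mem]
  · intro i' j'
    by_cases e : i' = i
    · subst e
      simp [hW', h.leg_mem]
      omega
    · simp [hW', h.leg_mem, e]

/-- The moves from a star. -/
theorem IsShape.star_move {W W' : Finset (BVertex I)} {c : Bool → Bool} {f : I → ℕ} {s : Bool}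
    (h : IsShape W c false f) (ha : Attached σ c f) (hs : c s = true) (hs' : c (!s) = false)
    (hm : TreeMove σ W' W) :
    (∃ i n, σ i = s ∧ Shortens n (f i) ∧ IsShape W' c false (Function.update f i n)) ∨
    ((∀ i, σ i = s → f i = 0) ∧ W' = ∅) ∨
    (∃ i lo, σ i = s ∧ lo ≤ 1 ∧ 0 < f i ∧ (∀ j, j ≠ i → σ j = σ i → f j = 0) ∧
      IsSegment W' i lo (f i)) ∨
    (∃ i i', i ≠ i' ∧ σ i = s ∧ σ i' = σ i ∧ f i' = 1 ∧
      (∀ j, j ≠ i → j ≠ i' → σ j = σ i → f j = 0) ∧ IsSegment W' i 0 (f i)) := by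
  have hsσ : ∀ i, 0 < f i → σ i = s := by
    intro i hi
    by_contra hne
    have e : σ i = !s := by
      cases hσ : σ i <;> cases s <;> simp_all
    have := ha i (by rw [e, hs'])
    omega
  have hmid : mid ∉ W := by simp [h.mid_mem]
  have hcs : cen s ∈ W := (h.cen_mem s).2 hs
  have hcen : ∀ t, cen t ∈ W → t = s := by
    intro t ht
    rw [h.cen_mem] at ht
    cases t <;> cases s <;> simp_all
  have ho : Orphan (par σ) W (cen s) := by
    intro p hp
    simp only [par, Option.some.injEq] at hp
    exact hp ▸ hmid
  obtain ⟨⟨x, hx, hW'⟩, hu⟩ := treeMove_iff.1 hm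
  have shorten : ∀ i j k, (k = j ∨ k = j + 1) → leg i k ∈ W →
      W' = (W.erase (leg i k)).erase (leg i j) →
      ∃ i n, σ i = s ∧ Shortens n (f i) ∧ IsShape W' c false (Function.update f i n) := by
    intro i j k hjk hk e
    rw [h.leg_mem] at hk
    obtain ⟨n, h1, h2⟩ := h.shorten_of_erase hcs (by simp) hjk hk e ho hu
    exact ⟨i, n, hsσ i (by omega), h1, h2⟩
  have orph : cen s ∉ W' → ∀ i, leg i 0 ∈ W' → Orphan (par σ) W' (leg i 0) := by
    intro hc i hi p hp
    simp only [par, Option.some.injEq] at hp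
    have : leg i 0 ∈ W := hm.subset hi
    rw [h.leg_mem] at this
    rw [← hp, hsσ i this]
    exact hc
  have unique : cen s ∉ W' → ∀ i i', leg i 0 ∈ W' → leg i' 0 ∈ W' → i = i' := by
    intro hc i i' hi hi'
    have := hu _ hi _ hi' (orph hc i hi) (orph hc i' hi')
    simpa using this
  have hmid' : mid ∉ W' := fun h => hmid (hm.subset h)
  have hcen' : cen s ∉ W' → ∀ t, cen t ∉ W' := fun hc t ht => hc (hcen t (hm.subset ht) ▸ ht)
  rcases x with _ | t | ⟨i, j⟩
  · exact absurd hx hmid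
  · obtain rfl := hcen t hx
    rcases hW' with rfl | ⟨p, hp, e, -⟩
    · have hc : cen t ∉ W.erase (cen t) := by simp
      by_cases hz : ∃ i, 0 < f i
      · obtain ⟨i, hi⟩ := hz
        have hz : ∀ j, j ≠ i → f j = 0 := by
          intro j hj
          by_contra h0
          exact hj (unique hc j i (by simp [h.leg_mem]; omega) (by simpa [h.leg_mem] using hi))
        refine .inr (.inr (.inl ⟨i, 0, hsσ i hi, by simp, hi, fun j hj _ => hz j hj,
          isSegment_of hmid' (hcen' hc) fun k j => ?_⟩))
        by_cases hk : k = i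
        · simp [hk, h.leg_mem]
        · simp [hk, h.leg_mem, hz k hk]
      · refine .inr (.inl ⟨fun i _ => by_contra fun h0 => hz ⟨i, by omega⟩, ?_⟩)
        refine Finset.eq_empty_of_forall_notMem ?_
        rintro (_ | u | ⟨i, j⟩)
        · exact hmid'
        · exact hcen' hc u
        · simp only [Finset.mem_erase, h.leg_mem, not_and]
          exact fun _ hj => hz ⟨i, by omega⟩
    · simp only [par, Option.some.injEq] at e
      exact absurd (e ▸ hp) hmid
  · rcases hW' with e | ⟨p, hp, e, hW'⟩
    · exact .inl (shorten i j j (.inl rfl) hx (by simpa using e))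
    rcases j with _ | j
    · have hi : 0 < f i := (h.leg_mem _ _).1 hx
      have hσi := hsσ i hi
      simp only [par, Option.some.injEq] at e
      subst e
      rw [hσi] at hW'
      have hc : cen s ∉ W' := by simp [hW']
      have hleg : ∀ k j, leg k j ∈ W' ↔ j < f k ∧ (k ≠ i ∨ j ≠ 0) := by
        intro k j
        simp [hW', h.leg_mem]
        tauto
      by_cases hz : ∃ k, k ≠ i ∧ 0 < f k
      · obtain ⟨k, hki, hk⟩ := hz
        have hk' : leg k 0 ∈ W' := (hleg k 0).2 ⟨hk, .inl hki⟩
        -- The centre and the first vertex of path `i` are gone while path `k` survives, so nothing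
        -- of path `i` may remain.
        have hfi : f i = 1 := by
          by_contra h1
          have := hu (leg k 0) hk' (leg i 1) ((hleg i 1).2 ⟨by omega, by simp⟩) (orph hc k hk') ?_
          · simp at this
          · intro p hp
            simp only [par, Option.some.injEq] at hp
            subst hp
            simp [hleg]
        have hz : ∀ j, j ≠ k → j ≠ i → f j = 0 := by
          intro j hjk hji
          by_contra h0
          exact hjk (unique hc j k ((hleg j 0).2 ⟨by omega, .inl hji⟩) hk')
        refine .inr (.inr (.inr ⟨k, i, hki, hsσ k hk, by rw [hσi, hsσ k hk], hfi,
          fun j hj hj' _ => hz j hj hj', isSegment_of hmid' (hcen' hc) fun l j => ?_⟩))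
        rw [hleg]
        by_cases hl : l = k
        · subst hl
          simp [hki]
        · by_cases hli : l = i
          · subst hli
            simp [hl]
            omega
          · simp [hl, hz l hl hli]
      · push Not at hz
        refine .inr (.inr (.inl ⟨i, 1, hσi, le_rfl, hi, fun j hj _ => by simpa using hz j hj,
          isSegment_of hmid' (hcen' hc) fun l j => ?_⟩))
        rw [hleg]
        by_cases hl : l = i
        · subst hl
          simp
          omega
        · have : f l = 0 := by simpa using hz l hl
          simp [hl, this]
    · simp only [par, Option.some.injEq] at e
      subst e
      exact .inl (shorten i j (j + 1) (.inr rfl) hx hW')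

/-- The moves from a bistar. -/
theorem IsShape.bistar_move {W W' : Finset (BVertex I)} {c : Bool → Bool} {f : I → ℕ}
    (h : IsShape W c true f) (ha : Attached σ c f) (hm : TreeMove σ W' W) :
    (∃ i n, Shortens n (f i) ∧ IsShape W' c true (Function.update f i n)) ∨
    (∃ s, c s = true ∧ (∀ i, σ i = s → f i = 0) ∧
      IsShape W' (Function.update c s false) true f) ∨
    (∃ i, c (σ i) = true ∧ f i = 1 ∧ (∀ j, j ≠ i → σ j = σ i → f j = 0) ∧
      IsShape W' (Function.update c (σ i) false) true (Function.update f i 0)) ∨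
    (∃ s, c s = false ∧ IsShape W' c false f) ∨
    (∃ s, c s = true ∧ (∀ i, σ i = s → f i = 0) ∧
      IsShape W' (Function.update c s false) false f) ∨
    (∃ i, c (σ i) = true ∧ c (!σ i) = false ∧ 0 < f i ∧ (∀ j, j ≠ i → σ j = σ i → f j = 0) ∧
      IsSegment W' i 0 (f i)) := by
  have hmid : mid ∈ W := h.mid_mem.2 rfl
  have ho : Orphan (par σ) W mid := by
    intro p hp
    simp [par] at hp
  have hcσ : ∀ i, 0 < f i → c (σ i) = true := by
    intro i hi
    by_contra hc
    have := ha i (by simpa using hc)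
    omega
  obtain ⟨⟨x, hx, hW'⟩, hu⟩ := treeMove_iff.1 hm
  have shorten : ∀ i j k, (k = j ∨ k = j + 1) → leg i k ∈ W →
      W' = (W.erase (leg i k)).erase (leg i j) →
      ∃ i n, Shortens n (f i) ∧ IsShape W' c true (Function.update f i n) := by
    intro i j k hjk hk e
    rw [h.leg_mem] at hk
    obtain ⟨n, h1, h2⟩ := h.shorten_of_erase hmid (by simp) hjk hk e ho hu
    exact ⟨i, n, h1, h2⟩
  have orph : ∀ i, cen (σ i) ∉ W' → Orphan (par σ) W' (leg i 0) := by
    intro i hc p hp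
    simp only [par, Option.some.injEq] at hp
    exact hp ▸ hc
  have orphc : ∀ s, mid ∉ W' → Orphan (par σ) W' (cen s) := by
    intro i hc p hp
    simp only [par, Option.some.injEq] at hp
    exact hp ▸ hc
  have orphm : Orphan (par σ) W' mid := by
    intro p hp
    simp [par] at hp
  rcases x with _ | s | ⟨i, j⟩
  · rcases hW' with rfl | ⟨p, hp, e, -⟩
    · have hs : ∃ s, c s = false := by
        by_contra! hc
        have := hu (cen false) (by simp [h.cen_mem, hc]) (cen true) (by simp [h.cen_mem, hc])
          (orphc _ (by simp)) (orphc _ (by simp))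
        simp at this
      obtain ⟨s, hs⟩ := hs
      exact .inr (.inr (.inr (.inl ⟨s, hs, by simp, by simp [h.cen_mem], by simp [h.leg_mem]⟩)))
    · simp [par] at e
  · have hs := (h.cen_mem s).1 hx
    rcases hW' with rfl | ⟨p, hp, e, hW'⟩
    · refine .inr (.inl ⟨s, hs, ?_, by simp [h.mid_mem], ?_, by simp [h.leg_mem]⟩)
      · rintro i rfl
        by_contra h0
        have := hu mid (by simpa using hmid) (leg i 0) (by simp [h.leg_mem]; omega) orphm
          (orph i (by simp))
        simp at this
      · intro t
        by_cases hts : t = s <;> simp [hts, h.cen_mem]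
    · simp only [par, Option.some.injEq] at e
      subst e
      have hm' : mid ∉ W' := by simp [hW']
      have hleg : ∀ k j, leg k j ∈ W' ↔ j < f k := by simp [hW', h.leg_mem]
      have hcen : ∀ t, cen t ∈ W' ↔ t ≠ s ∧ c t = true := by simp [hW', h.cen_mem]
      by_cases hz : ∀ i, σ i = s → f i = 0
      · refine .inr (.inr (.inr (.inr (.inl ⟨s, hs, hz, by simp [hm'], ?_, hleg⟩))))
        intro t
        by_cases hts : t = s <;> simp [hts, hcen]
      · push Not at hz
        obtain ⟨i, rfl, hi⟩ := hz
        have hi : 0 < f i := by omega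
        have hc : cen (σ i) ∉ W' := by simp [hcen]
        -- With the middle vertex and one centre removed, the surviving path already has an orphan,
        -- which excludes the other centre and any second path.
        have hc' : c (!σ i) = false := by
          by_contra hc'
          have := hu (leg i 0) ((hleg _ _).2 hi) (cen (!σ i))
            ((hcen _).2 ⟨by simp, by simpa using hc'⟩) (orph i hc) (orphc _ hm')
          simp at this
        have hz : ∀ j, j ≠ i → σ j = σ i → f j = 0 := by
          intro j hj hσ
          by_contra h0
          have := hu (leg j 0) ((hleg _ _).2 (by omega)) (leg i 0) ((hleg _ _).2 hi)
            (orph j (hσ ▸ hc)) (orph i hc)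
          simp [hj] at this
        refine .inr (.inr (.inr (.inr (.inr ⟨i, hs, hc', hi, hz, isSegment_of hm' ?_ ?_⟩))))
        · intro t ht
          obtain ⟨h1, h2⟩ := (hcen t).1 ht
          cases t <;> cases hσ : σ i <;> simp_all
        · intro k j
          rw [hleg]
          by_cases hk : k = i
          · simp [hk]
          · have : f k = 0 := by
              by_contra h0
              have h1 := hcσ k (by omega)
              have h2 := mt (hz k hk) h0
              cases hσ : σ i <;> cases hσ' : σ k <;> simp_all
            simp [hk, this]
  · rcases hW' with e | ⟨p, hp, e, hW'⟩
    · exact .inl (shorten i j j (.inl rfl) hx (by simpa using e))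
    rcases j with _ | j
    · simp only [par, Option.some.injEq] at e
      subst e
      have hi : 0 < f i := (h.leg_mem _ _).1 hx
      have hm' : mid ∈ W' := by simp [hW', hmid]
      have hc : cen (σ i) ∉ W' := by simp [hW']
      have hleg : ∀ k j, leg k j ∈ W' ↔ j < f k ∧ (k ≠ i ∨ j ≠ 0) := by
        intro k j
        simp [hW', h.leg_mem]
        tauto
      -- The middle vertex remains as an orphan, so the deleted centre must leave no part of its
      -- path behind.
      have hfi : f i = 1 := by
        by_contra h1
        have := hu mid hm' (leg i 1) ((hleg i 1).2 ⟨by omega, by simp⟩) orphm ?_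
        · simp at this
        · intro p hp
          simp only [par, Option.some.injEq] at hp
          subst hp
          simp [hleg]
      refine .inr (.inr (.inl ⟨i, (h.cen_mem _).1 hp, hfi, ?_, by simp [hm'], ?_, ?_⟩))
      · intro k hk hσ
        by_contra h0
        have := hu mid hm' (leg k 0) ((hleg k 0).2 ⟨by omega, .inl hk⟩) orphm (orph k (hσ ▸ hc))
        simp at this
      · intro t
        by_cases hts : t = σ i <;> simp [hts, hW', h.cen_mem]
      · intro k j
        rw [hleg]
        by_cases hk : k = i
        · subst hk
          simp
          omega
        · simp [hk]
    · simp only [par, Option.some.injEq] at e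
      subst e
      exact .inl (shorten i j (j + 1) (.inr rfl) hx hW')

end Moves

/-! ### Grundy values of paths, stars and bistars in the tree -/

section Values

variable {I : Type*} [DecidableEq I] {σ : I → Bool}

theorem grundy_treeMove_empty : grundy (TreeMove σ) ∅ = 0 := by
  refine grundy_eq_of (fun W' hm => ?_) (by simp)
  obtain ⟨⟨x, hx, -⟩, -⟩ := treeMove_iff.1 hm
  simp at hx

theorem IsSegment.erase {W : Finset (BVertex I)} {i : I} {lo hi lo' hi' j k : ℕ}
    (h : IsSegment W i lo hi)
    (hjk : ∀ l, lo' ≤ l ∧ l < hi' ↔ (lo ≤ l ∧ l < hi) ∧ l ≠ j ∧ l ≠ k) :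
    IsSegment ((W.erase (leg i k)).erase (leg i j)) i lo' hi' := by
  intro x
  simp only [Finset.mem_erase]
  constructor
  · rintro ⟨h1, h2, h3⟩
    obtain ⟨l, hl1, hl2, rfl⟩ := (h x).1 h3
    obtain ⟨h4, h5⟩ := (hjk l).2 ⟨⟨hl1, hl2⟩, by simpa using h1, by simpa using h2⟩
    exact ⟨l, h4, h5, rfl⟩
  · rintro ⟨l, hl1, hl2, rfl⟩
    obtain ⟨h4, h5, h6⟩ := (hjk l).1 ⟨hl1, hl2⟩
    exact ⟨by simpa using h5, by simpa using h6, h.leg_mem.2 h4⟩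

theorem IsSegment.of_move {W W' : Finset (BVertex I)} {i : I} {lo hi : ℕ}
    (h : IsSegment W i lo hi) (hm : TreeMove σ W' W) :
    ∃ lo' hi', Shortens (hi' - lo') (hi - lo) ∧ IsSegment W' i lo' hi' := by
  have hsub := hm.subset
  obtain ⟨⟨x, hx, hW'⟩, hu⟩ := treeMove_iff.1 hm
  obtain ⟨k, hk1, hk2, rfl⟩ := (h x).1 hx
  obtain ⟨j, hj, hjk, hW'⟩ : ∃ j, lo ≤ j ∧ (k = j ∨ k = j + 1) ∧
      W' = (W.erase (leg i k)).erase (leg i j) := by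
    rcases hW' with e | ⟨p, hp, e, hW'⟩
    · exact ⟨k, hk1, .inl rfl, by simpa using e⟩
    · obtain ⟨j, hj1, hj2, rfl⟩ := (h p).1 hp
      rcases k with _ | k
      · simp [par] at e
      · simp only [par, Option.some.injEq, leg.injEq, true_and] at e
        subst e
        exact ⟨_, hj1, .inr rfl, hW'⟩
  by_cases hlo : j = lo
  · refine ⟨k + 1, hi, by unfold Shortens; omega, hW' ▸ h.erase fun l => by omega⟩
  by_cases hhi : k + 1 = hi
  · refine ⟨lo, j, by unfold Shortens; omega, hW' ▸ h.erase fun l => by omega⟩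
  -- A deletion strictly inside the segment leaves two orphans, `leg i lo` and `leg i (k + 1)`.
  exfalso
  have := hu (leg i lo) (by simp [hW', h.leg_mem]; omega) (leg i (k + 1))
    (by simp [hW', h.leg_mem]; omega) (h.orphan hsub ?_) (h.orphan hsub ?_)
  · simp at this
    omega
  · intro l hl hlW
    have := h.leg_mem.1 (hsub hlW)
    omega
  · intro l hl
    obtain rfl : l = k := by omega
    simp [hW']

theorem IsSegment.exists_move {W : Finset (BVertex I)} {i : I} {lo hi n : ℕ}
    (h : IsSegment W i lo hi) (hn : Shortens n (hi - lo)) :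
    ∃ W', TreeMove σ W' W ∧ IsSegment W' i lo (lo + n) := by
  rcases hn with hn | hn
  · have h' := h.erase (lo' := lo) (hi' := lo + n) (j := lo + n) (k := lo + n) fun l => by omega
    exact ⟨_, treeMove_iff.2 ⟨⟨leg i (lo + n), h.leg_mem.2 ⟨by omega, by omega⟩, .inl (by simp)⟩,
      h'.rootUnique⟩, h'⟩
  · have h' := h.erase (lo' := lo) (hi' := lo + n) (j := lo + n) (k := lo + n + 1)
      fun l => by omega
    exact ⟨_, treeMove_iff.2 ⟨⟨leg i (lo + n + 1), h.leg_mem.2 ⟨by omega, by omega⟩,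
      .inr ⟨leg i (lo + n), h.leg_mem.2 ⟨by omega, by omega⟩, rfl, rfl⟩⟩, h'.rootUnique⟩, h'⟩

/-- On a path the legal moves take one or two vertices from an end, so this is the subtraction game
modulo 3. -/
theorem IsSegment.grundy_eq {W : Finset (BVertex I)} {i : I} {lo hi : ℕ}
    (h : IsSegment W i lo hi) : grundy (TreeMove σ) W = (hi - lo) % 3 := by
  induction W using (OctalMove.isWellFounded (forestGraph (par σ))).wf.induction
    generalizing lo hi with
  | _ W ih =>
    refine grundy_eq_of (fun W' hm => ?_) (fun u hu => ?_)
    · obtain ⟨lo', hi', hs, h'⟩ := h.of_move hm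
      rw [ih W' hm h']
      exact hs.mod_ne
    · obtain ⟨n, hn, rfl⟩ : ∃ n, Shortens n (hi - lo) ∧ n % 3 = u := by
        unfold Shortens
        by_cases h1 : (hi - lo - 1) % 3 = u
        · exact ⟨hi - lo - 1, by omega, h1⟩
        · exact ⟨hi - lo - 2, by omega, by omega⟩
      obtain ⟨W', hm, h'⟩ := h.exists_move (σ := σ) hn
      refine ⟨W', hm, ?_⟩
      rw [ih W' hm h']
      simp

theorem Attached.update {c : Bool → Bool} {f : I → ℕ} (h : Attached σ c f) {i : I} {n : ℕ}
    (hn : Shortens n (f i)) : Attached σ c (Function.update f i n) := by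
  intro j hj
  by_cases e : j = i
  · subst e
    have := h j hj
    unfold Shortens at hn
    omega
  · simpa [e] using h j hj

variable [Fintype I]

/-- If the centre is deleted, at most one path survives, so the star was itself a path and the
residues can be compared directly. All other moves shorten a path and are excluded by
`val_joinPath_ne`. -/
theorem IsShape.grundy_star {W : Finset (BVertex I)} {c : Bool → Bool} {f : I → ℕ} {s : Bool}
    (h : IsShape W c false f) (ha : Attached σ c f) (hs : c s = true) (hs' : c (!s) = false) :
    grundy (TreeMove σ) W = (sideClass σ f s).val := by
  induction W using (OctalMove.isWellFounded (forestGraph (par σ))).wf.induction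
    generalizing f with
  | _ W ih =>
    have hleg : ∀ i j, leg i j ∈ W → σ i = s := by
      intro i j hij
      rw [h.leg_mem] at hij
      by_contra hne
      have e : σ i = !s := by
        cases hσ : σ i <;> cases s <;> simp_all
      have := ha i (by rw [e, hs'])
      omega
    have hempty : ∀ W' ⊆ W, cen s ∉ W' → (∀ i j, σ i = s → leg i j ∉ W') → W' = ∅ := by
      intro W' hW' hc hl
      refine Finset.eq_empty_of_forall_notMem ?_
      rintro (_ | t | ⟨i, j⟩) hx
      · simpa [h.mid_mem] using hW' hx
      · have := (h.cen_mem t).1 (hW' hx)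
        cases t <;> cases s <;> simp_all
      · exact hl i j (hleg i j (hW' hx)) hx
    have hroot : RootUnique (par σ) (∅ : Finset (BVertex I)) := by
      intro u hu
      simp at hu
    have hcs := (h.cen_mem s).2 hs
    refine grundy_eq_of (fun W' hm => ?_) (fun u hu => ?_)
    · rcases h.star_move ha hs hs' hm with ⟨i, n, rfl, hn, h'⟩ | ⟨hz, rfl⟩ |
        ⟨i, lo, rfl, hlo, hi, hz, h'⟩ | ⟨i, i', hne, rfl, hσ, h1, hz, h'⟩
      · rw [ih W' hm h' (ha.update hn), sideClass_update, sideClass_eq_joinPath]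
        exact StarClass.val_joinPath_ne _ _ (Nat.mod_lt _ (by norm_num))
          (Nat.mod_lt _ (by norm_num)) hn.mod_ne
      · rw [grundy_treeMove_empty, sideClass_of_zero hz]
        exact zero_ne_one
      · rw [h'.grundy_eq, sideClass_of_single hz]
        have h3 : f i % 3 < 3 := Nat.mod_lt _ (by norm_num)
        generalize hr : f i % 3 = r at h3
        interval_cases r <;> simp [StarClass.joinPath, StarClass.ofCounts, StarClass.val] <;> omega
      · rw [h'.grundy_eq, sideClass_of_pair hne hσ h1 hz]
        have h3 : f i % 3 < 3 := Nat.mod_lt _ (by norm_num)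
        interval_cases f i % 3 <;> simp [StarClass.joinPath, StarClass.ofCounts, StarClass.val]
    · obtain ⟨k, hk, e, ho⟩ := exists_kind_of_side (σ := σ) f s
      obtain ⟨d, hd, rfl⟩ := StarClass.exists_of_lt_val hk u (e ▸ hu)
      rcases ho d hd with ⟨i, n, hi, hn, hd⟩ | ⟨hz, hd⟩ | ⟨i, rfl, h1, hz, rfl⟩
      · obtain ⟨W', h', hm⟩ := h.exists_shorten (σ := σ) hn
        have hm := hm (h'.rootUnique_star (ha.update hn) hs')
        exact ⟨W', hm, by rw [ih W' hm h' (ha.update hn), hd]⟩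
      · rw [sideClass_of_zero hz] at hu
        rcases hd with rfl | rfl
        · have e' := hempty (W.erase (cen s)) (Finset.erase_subset _ _) (by simp)
            (fun i j hi => by simp [h.leg_mem, hz i hi])
          exact ⟨∅, treeMove_iff.2 ⟨⟨cen s, hcs, .inl e'.symm⟩, hroot⟩, grundy_treeMove_empty⟩
        -- The single vertex has value 1, so the option `d2s` of value 2 listed for its kind is not
        -- needed here.
        · simp [StarClass.val] at hu
      · have e' := hempty ((W.erase (leg i 0)).erase (cen (σ i)))
          ((Finset.erase_subset _ _).trans (Finset.erase_subset _ _)) (by simp) (by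
            intro k j hk
            by_cases hki : k = i
            · subst hki
              simp [h.leg_mem, h1]
            · simp [h.leg_mem, hz k hki hk])
        exact ⟨∅, treeMove_iff.2 ⟨⟨leg i 0, (h.leg_mem _ _).2 (by omega),
          .inr ⟨cen (σ i), hcs, rfl, e'.symm⟩⟩, hroot⟩, grundy_treeMove_empty⟩

/-- The Grundy value when the middle vertex and one centre are absent. -/
theorem IsShape.grundy_lone {W : Finset (BVertex I)} {c : Bool → Bool} {f : I → ℕ} {s : Bool}
    (h : IsShape W c false f) (ha : Attached σ c f) (hs : c s = false) :
    grundy (TreeMove σ) W = (starClass σ c f !s).val := by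
  by_cases hs' : c (!s) = true
  · rw [starClass_of_present hs']
    exact h.grundy_star ha hs' (by simpa using hs)
  · have hc : ∀ t, c t = false := by
      intro t
      cases t <;> cases s <;> simp_all
    obtain rfl : W = ∅ := by
      refine Finset.eq_empty_of_forall_notMem ?_
      rintro (_ | t | ⟨i, j⟩)
      · simp [h.mid_mem]
      · simp [h.cen_mem, hc]
      · simp [h.leg_mem, ha i (hc _)]
    rw [grundy_treeMove_empty, starClass, if_neg hs']
    rfl

theorem starClass_shorten_not (c : Bool → Bool) (f : I → ℕ) (i : I) (n : ℕ) :
    starClass σ c (Function.update f i n) (!σ i) = starClass σ c f !σ i := by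
  simp [starClass, sideClass_update_of_ne]

/-- Moves from a bistar realizing the options of a kind on one side; removing the middle vertex has the
same effect as an option of class `d2s`. -/
theorem IsShape.exists_kind {W : Finset (BVertex I)} {c : Bool → Bool} {f : I → ℕ}
    (h : IsShape W c true f) (ha : Attached σ c f) (s : Bool) :
    ∃ k ∈ StarClass.kinds, k.1 = starClass σ c f s ∧ ∀ d ∈ k.2, ∃ W', TreeMove σ W' W ∧
      ((∃ c' f', IsShape W' c' true f' ∧ Attached σ c' f' ∧ starClass σ c' f' s = d ∧
        starClass σ c' f' (!s) = starClass σ c f !s) ∨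
      (d = .d2s ∧ ∃ c', IsShape W' c' false f ∧ Attached σ c' f ∧ c' s = false ∧
        starClass σ c' f (!s) = starClass σ c f !s)) := by
  have hmid : mid ∈ W := h.mid_mem.2 rfl
  by_cases hs : c s = true
  · have hcs := (h.cen_mem s).2 hs
    obtain ⟨k, hk, e, ho⟩ := exists_kind_of_side (σ := σ) f s
    refine ⟨k, hk, by rw [e, starClass_of_present hs], fun d hd => ?_⟩
    rcases ho d hd with ⟨i, n, rfl, hn, rfl⟩ | ⟨hz, rfl | rfl⟩ | ⟨i, rfl, h1, hz, rfl⟩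
    · obtain ⟨W', h', hm⟩ := h.exists_shorten (σ := σ) hn
      refine ⟨W', hm (h'.rootUnique_bistar (ha.update hn)), .inl ⟨c, _, h', ha.update hn, ?_,
        starClass_shorten_not ..⟩⟩
      rw [starClass_of_present hs]
    · have h' : IsShape (W.erase (cen s)) (Function.update c s false) true f := by
        refine ⟨by simp [h.mid_mem], fun t => ?_, by simp [h.leg_mem]⟩
        by_cases e : t = s <;> simp [e, h.cen_mem]
      exact ⟨_, treeMove_iff.2 ⟨⟨cen s, hcs, .inl rfl⟩, h'.rootUnique_bistar (ha.remove hz)⟩,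
        .inl ⟨_, _, h', ha.remove hz, starClass_remove .., starClass_remove_not _ fun _ _ => rfl⟩⟩
    · have h' : IsShape ((W.erase (cen s)).erase mid) (Function.update c s false) false f := by
        refine ⟨by simp, fun t => ?_, by simp [h.leg_mem]⟩
        by_cases e : t = s <;> simp [e, h.cen_mem]
      exact ⟨_, treeMove_iff.2 ⟨⟨cen s, hcs, .inr ⟨mid, hmid, rfl, rfl⟩⟩,
        h'.rootUnique_star (s := !s) (ha.remove hz) (by simp)⟩,
        .inr ⟨rfl, _, h', ha.remove hz, by simp, starClass_remove_not _ fun _ _ => rfl⟩⟩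
    · have h' : IsShape ((W.erase (leg i 0)).erase (cen (σ i)))
          (Function.update c (σ i) false) true (Function.update f i 0) := by
        refine ⟨by simp [h.mid_mem], fun t => ?_, fun k j => ?_⟩
        · by_cases e : t = σ i <;> simp [e, h.cen_mem]
        · by_cases e : k = i
          · subst e
            simp [h.leg_mem, h1]
          · simp [e, h.leg_mem]
      have ha' : Attached σ (Function.update c (σ i) false) (Function.update f i 0) := by
        refine (ha.update (.inl h1.symm)).remove fun k hk => ?_
        by_cases e : k = i
        · simp [e]
        · simpa [e] using hz k e hk
      refine ⟨_, treeMove_iff.2 ⟨⟨leg i 0, (h.leg_mem _ _).2 (by omega),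
        .inr ⟨cen (σ i), hcs, rfl, rfl⟩⟩, h'.rootUnique_bistar ha'⟩,
        .inl ⟨_, _, h', ha', starClass_remove .., starClass_remove_not _ fun k hk => ?_⟩⟩
      have : k ≠ i := by
        rintro rfl
        simp at hk
      simp [this]
  · refine ⟨(.d0s, [.d2s]), by simp [StarClass.kinds], by simp [starClass, hs], ?_⟩
    have hs : c s = false := by simpa using hs
    rintro d hd
    obtain rfl : d = .d2s := by simpa using hd
    have h' : IsShape (W.erase mid) c false f :=
      ⟨by simp, by simp [h.cen_mem], by simp [h.leg_mem]⟩
    exact ⟨_, treeMove_iff.2 ⟨⟨mid, hmid, .inl rfl⟩,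
      h'.rootUnique_star (s := !s) ha (by simpa using hs)⟩, .inr ⟨rfl, c, h', ha, hs, rfl⟩⟩

/-- By `bistar_move`, each option changes the class on one side within a triple of distinct table
entries, except when a single path is left. By `exists_kind`, the options of the kinds of both sides
are realized by moves. -/
theorem IsShape.grundy_bistar {W : Finset (BVertex I)} {c : Bool → Bool} {f : I → ℕ}
    (h : IsShape W c true f) (ha : Attached σ c f) :
    grundy (TreeMove σ) W = StarClass.val₂ (starClass σ c f false) (starClass σ c f true) := by
  induction W using (OctalMove.isWellFounded (forestGraph (par σ))).wf.induction
    generalizing c f with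
  | _ W ih =>
    -- The classes `d1s`, `d2s`, `d0s` of `P_1`, `P_2` and the empty star are `joinPath 0 0` at
    -- residues 0, 1, 2.
    have base : ∀ d : StarClass, (StarClass.val₂ .d1s d ≠ StarClass.val₂ .d2s d ∧
        StarClass.val₂ .d1s d ≠ StarClass.val₂ .d0s d ∧
        StarClass.val₂ .d2s d ≠ StarClass.val₂ .d0s d) :=
      StarClass.val₂_joinPath_pairwise_ne 0 0
    refine grundy_eq_of (fun W' hm => ?_) ?_
    · rcases h.bistar_move ha hm with ⟨i, n, hn, h'⟩ | ⟨s, hs, hz, h'⟩ | ⟨i, hs, h1, hz, h'⟩ |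
        ⟨s, hs, h'⟩ | ⟨s, hs, hz, h'⟩ | ⟨i, hs, hs', hi, hz, h'⟩
      · have hs : c (σ i) = true := by
          by_contra hc
          have := ha i (by simpa using hc)
          unfold Shortens at hn
          omega
        rw [ih W' hm h' (ha.update hn), val₂_starClass _ _ (σ i), val₂_starClass _ f (σ i),
          starClass_shorten_not, starClass_of_present hs, starClass_of_present hs, sideClass_update,
          sideClass_eq_joinPath]
        exact StarClass.val₂_joinPath_ne _ _ _ (Nat.mod_lt _ (by norm_num))
          (Nat.mod_lt _ (by norm_num)) hn.mod_ne
      · rw [ih W' hm h' (ha.remove hz), val₂_starClass _ _ s, val₂_starClass c f s,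
          starClass_remove, starClass_remove_not _ fun _ _ => rfl, starClass_of_present hs,
          sideClass_of_zero hz]
        exact (base _).2.1.symm
      · have ha' : Attached σ (Function.update c (σ i) false) (Function.update f i 0) := by
          refine (ha.update (.inl h1.symm)).remove fun k hk => ?_
          by_cases e : k = i
          · simp [e]
          · simpa [e] using hz k e hk
        have hf : ∀ k, σ k = (!σ i) → Function.update f i 0 k = f k := by
          intro k hk
          have : k ≠ i := by
            rintro rfl
            simp at hk
          simp [this]
        rw [ih W' hm h' ha', val₂_starClass _ _ (σ i), val₂_starClass c f (σ i),
          starClass_remove, starClass_remove_not _ hf, starClass_of_present hs,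
          sideClass_of_single hz, h1]
        exact (base _).2.2.symm
      -- Deleting the middle vertex acts as replacing the empty side, of class `d0s`, by `d2s`.
      · rw [h'.grundy_lone ha hs, val₂_starClass _ _ s, ← StarClass.val₂_d2s,
          starClass_of_absent hs]
        exact (base _).2.2
      · rw [h'.grundy_lone (s := s) (ha.remove hz) (by simp), val₂_starClass c f s,
          ← StarClass.val₂_d2s, starClass_remove_not _ fun _ _ => rfl,
          starClass_of_present hs, sideClass_of_zero hz]
        exact (base _).1.symm
      -- Here the position was a path with `f i + 2` vertices up to absent legs, and its two end
      -- vertices are removed.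
      · rw [h'.grundy_eq, val₂_starClass c f (σ i), starClass_of_present hs,
          starClass_of_absent hs', sideClass_of_single hz, Nat.sub_zero]
        have h3 : f i % 3 < 3 := Nat.mod_lt _ (by norm_num)
        interval_cases f i % 3 <;> decide
    · intro u hu
      have real : ∀ s d W', TreeMove σ W' W →
          ((∃ c' f', IsShape W' c' true f' ∧ Attached σ c' f' ∧ starClass σ c' f' s = d ∧
            starClass σ c' f' (!s) = starClass σ c f !s) ∨
          (d = .d2s ∧ ∃ c', IsShape W' c' false f ∧ Attached σ c' f ∧ c' s = false ∧
            starClass σ c' f (!s) = starClass σ c f !s)) →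
          grundy (TreeMove σ) W' = StarClass.val₂ d (starClass σ c f !s) := by
        rintro s d W' hm (⟨c', f', h', ha', rfl, e⟩ | ⟨rfl, c', h', ha', hs, e⟩)
        · rw [ih W' hm h' ha', val₂_starClass _ _ s, e]
        · rw [h'.grundy_lone ha' hs, e, StarClass.val₂_d2s]
      obtain ⟨k, hk, e, ho⟩ := h.exists_kind ha false
      obtain ⟨k', hk', e', ho'⟩ := h.exists_kind ha true
      rw [← e, ← e'] at hu
      rcases StarClass.exists_of_lt_val₂ hk hk' u hu with ⟨d, hd, rfl⟩ | ⟨d, hd, rfl⟩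
      · obtain ⟨W', hm, hW'⟩ := ho d hd
        exact ⟨W', hm, by rw [real _ _ _ hm hW', e']; rfl⟩
      · obtain ⟨W', hm, hW'⟩ := ho' d hd
        exact ⟨W', hm, by rw [real _ _ _ hm hW', StarClass.val₂_comm, e]; rfl⟩

end Values

/-! ### Stars and bistars as subgraphs of the tree -/

theorem List.card_filter_get (L : List ℕ) (p : ℕ → Prop) [DecidablePred p] :
    (Finset.univ.filter fun i : Fin L.length => p (L.get i)).card = L.countP p := by
  have h : (Finset.univ.val.map L.get : Multiset ℕ) = (L : Multiset ℕ) := by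
    rw [Fin.univ_val_map, List.ofFn_get]
  rw [← Multiset.coe_countP, ← h, Multiset.countP_map]
  rfl

theorem pathCount_eq_countP {I : Type*} [Fintype I] {σ : I → Bool} {f : I → ℕ} {s : Bool}
    {L : List ℕ} (e : Fin L.length ↪ I) (hσ : ∀ i, σ i = s ↔ i ∈ Set.range e)
    (hf : ∀ i, f (e i) = L.get i) (r : ℕ) : pathCount σ f s r = L.countP (· % 3 = r) := by
  rw [← List.card_filter_get, pathCount, ← Finset.card_map e]
  congr 1
  ext i
  simp only [Finset.mem_filter, Finset.mem_univ, true_and, Finset.mem_map, hσ]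
  constructor
  · rintro ⟨⟨j, rfl⟩, h⟩
    exact ⟨j, by rwa [← hf], rfl⟩
  · rintro ⟨j, h, rfl⟩
    exact ⟨⟨j, rfl⟩, by rwa [hf]⟩

namespace SubdividedStar

/-- The lengths of the paths. -/
def legs : SubdividedStar → List ℕ
  | empty => []
  | star paths _ => paths

/-- Whether the star has a centre. -/
def present : SubdividedStar → Bool
  | empty => false
  | star _ _ => true

theorem legs_eq_nil {S : SubdividedStar} (h : S.present = false) : S.legs = [] := by
  cases S
  · rfl
  · simp [present] at h

/-- The class of a star. -/
def cls : SubdividedStar → StarClass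
  | empty => .d0s
  | star paths _ => .ofCounts (paths.countP (· % 3 = 1)) (paths.countP (· % 3 = 2))

theorem starClass_eq_cls (S : SubdividedStar) {I : Type*} [Fintype I] {σ : I → Bool} {f : I → ℕ}
    {s : Bool} {c : Bool → Bool} (e : Fin S.legs.length ↪ I)
    (hσ : ∀ i, σ i = s ↔ i ∈ Set.range e) (hf : ∀ i, f (e i) = S.legs.get i)
    (hc : c s = S.present) : starClass σ c f s = S.cls := by
  cases S
  · exact starClass_of_absent hc f
  · rw [starClass_of_present hc, sideClass, pathCount_eq_countP e hσ hf,
      pathCount_eq_countP e hσ hf]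
    rfl

/-! ### Embedding a star in the tree -/

section Embedding

variable {I : Type*}

/-- The vertices of a star as vertices of the tree. -/
def toTree : (S : SubdividedStar) → (s : Bool) → (Fin S.legs.length → I) → S.Vertex → BVertex I
  | star _ _, s, _, none => cen s
  | star _ _, _, e, some ⟨i, j⟩ => leg (e i) j

variable {σ : I → Bool} {s : Bool}

theorem par_mid : par σ mid = none := rfl

theorem toTree_injective (S : SubdividedStar) (s : Bool) {e : Fin S.legs.length → I}
    (he : Function.Injective e) : Function.Injective (S.toTree s e) := by
  rcases S with _ | ⟨L, pos⟩
  · rintro ⟨⟩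
  · rintro (_ | ⟨i, j⟩) (_ | ⟨i', j'⟩) h
    · rfl
    · simp [toTree] at h
    · simp [toTree] at h
    · simp only [toTree, leg.injEq] at h
      obtain ⟨h1, h2⟩ := h
      obtain rfl := he h1
      obtain rfl := Fin.ext h2
      rfl

theorem toTree_ne_mid {S : SubdividedStar} {e : Fin S.legs.length → I} (v : S.Vertex) :
    S.toTree s e v ≠ mid := by
  rcases S with _ | ⟨L, pos⟩
  · cases v
  · rcases v with _ | ⟨i, j⟩ <;> simp [toTree]

theorem par_toTree_eq_mid {S : SubdividedStar} {e : Fin S.legs.length → I} (v : S.Vertex) :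
    par σ (S.toTree s e v) = some mid ↔ S.IsCenter v := by
  rcases S with _ | ⟨L, pos⟩
  · cases v
  · rcases v with _ | ⟨i, _ | j, hj⟩ <;> simp [toTree, par, IsCenter]
    rfl

theorem par_toTree {S : SubdividedStar} {e : Fin S.legs.length → I} (he : Function.Injective e)
    (hσ : ∀ i, σ (e i) = s) (u v : S.Vertex) :
    par σ (S.toTree s e v) = some (S.toTree s e u) ↔ S.Step u v := by
  rcases S with _ | ⟨L, pos⟩
  · cases v
  · rcases v with _ | ⟨i, _ | j, hj⟩ <;> rcases u with _ | ⟨i', j', hj'⟩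
    · simp [toTree, par, Step]
    · simp [toTree, par, Step]
    · exact ⟨fun _ => rfl, fun _ => congrArg (fun t => some (cen t)) (hσ i)⟩
    · simp [toTree, par, Step]
    · simp [toTree, par, Step]
    · simp only [toTree, par, Step, Option.some.injEq, leg.injEq, Nat.add_right_cancel_iff]
      exact and_congr (he.eq_iff.trans eq_comm) Iff.rfl

theorem toTree_adj {S : SubdividedStar} {e : Fin S.legs.length → I} (he : Function.Injective e)
    (hσ : ∀ i, σ (e i) = s) (u v : S.Vertex) :
    (forestGraph (par σ)).Adj (S.toTree s e u) (S.toTree s e v) ↔ S.graph.Adj u v := by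
  have h := forestGraph_adj (depth_lt σ) (u := S.toTree s e u) (v := S.toTree s e v)
  rw [par_toTree he hσ, par_toTree he hσ] at h
  rw [graph, SimpleGraph.fromRel_adj, h, or_comm]
  refine ⟨fun h' => ⟨?_, h'⟩, And.right⟩
  rintro rfl
  exact (h.2 h'.symm).ne rfl

theorem exists_toTree_eq_cen {S : SubdividedStar} {e : Fin S.legs.length → I} (t : Bool) :
    (∃ v, S.toTree s e v = cen t) ↔ t = s ∧ S.present = true := by
  rcases S with _ | ⟨L, pos⟩
  · simp only [present, Bool.false_eq_true, and_false, iff_false]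
    rintro ⟨⟨⟩⟩
  · simp only [present, and_true]
    constructor
    · rintro ⟨_ | ⟨i, j⟩, h⟩
      · simpa [toTree] using h.symm
      · simp [toTree] at h
    · rintro rfl
      exact ⟨none, rfl⟩

theorem exists_toTree_eq_leg {S : SubdividedStar} {e : Fin S.legs.length → I} (i : I) (j : ℕ) :
    (∃ v, S.toTree s e v = leg i j) ↔ ∃ k, e k = i ∧ j < S.legs.get k := by
  rcases S with _ | ⟨L, pos⟩
  · constructor
    · rintro ⟨⟨⟩⟩
    · rintro ⟨⟨k, hk⟩, -⟩
      simp [legs] at hk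
  · constructor
    · rintro ⟨_ | ⟨k, l⟩, h⟩
      · simp [toTree] at h
      · simp only [toTree, leg.injEq] at h
        obtain ⟨rfl, rfl⟩ := h
        exact ⟨k, rfl, l.2⟩
    · rintro ⟨k, rfl, hj⟩
      exact ⟨some ⟨k, j, hj⟩, rfl⟩

end Embedding

/-- The star is placed on the side `false` of the tree, without the middle vertex; `grundy_lone`
also covers the empty star. -/
theorem value_eq (S : SubdividedStar) : S.value = S.cls.val := by
  let σ : Fin S.legs.length → Bool := fun _ => false
  let c : Bool → Bool := fun t => !t && S.present
  let φ : S.graph ↪g forestGraph (par σ) :=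
    { toFun := S.toTree false id
      inj' := S.toTree_injective false Function.injective_id
      map_rel_iff' := toTree_adj Function.injective_id (fun _ => rfl) _ _ }
  have hW : IsShape (Finset.univ.map φ.toEmbedding) c false S.legs.get := by
    refine ⟨?_, fun t => ?_, fun i j => ?_⟩
    · simpa [φ] using fun v => toTree_ne_mid v
    · have := exists_toTree_eq_cen (S := S) (s := false) (e := id) t
      simpa [φ, c] using this
    · have := exists_toTree_eq_leg (S := S) (s := false) (e := id) i j
      simpa [φ] using this
  have ha : Attached σ c S.legs.get := by
    intro i hi
    have h := legs_eq_nil (S := S) (by simpa [c, σ] using hi)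
    exact absurd i.2 (by simp [h])
  rw [value, grundyValue, ← grundy_map φ]
  refine (hW.grundy_lone (s := true) ha rfl).trans ?_
  rw [← S.starClass_eq_cls (σ := σ) (f := S.legs.get) (s := !true) (c := c)
    (Function.Embedding.refl _) (by simp [σ]) (fun _ => rfl) (by simp [c])]

theorem grundyValue_bistar (S S' : SubdividedStar) :
    grundyValue (S.bistar S') = StarClass.val₂ S.cls S'.cls := by
  let I := Fin S.legs.length ⊕ Fin S'.legs.length
  let σ : I → Bool := Sum.isRight
  let c : Bool → Bool := fun t => if t then S'.present else S.present
  let f : I → ℕ := Sum.elim S.legs.get S'.legs.get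
  let g : S.Vertex ⊕ Unit ⊕ S'.Vertex → BVertex I :=
    Sum.elim (S.toTree false Sum.inl) (Sum.elim (fun _ => mid) (S'.toTree true Sum.inr))
  have hl : Function.Injective (Sum.inl : Fin S.legs.length → I) := Sum.inl_injective
  have hr : Function.Injective (Sum.inr : Fin S'.legs.length → I) := Sum.inr_injective
  have hlr : ∀ u v, S.toTree false (Sum.inl : Fin S.legs.length → I) u ≠
      S'.toTree true (Sum.inr : Fin S'.legs.length → I) v := by
    intro u v
    rcases S with _ | ⟨L, pos⟩
    · cases u
    rcases S' with _ | ⟨L', pos'⟩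
    · cases v
    rcases u with _ | ⟨i, j⟩ <;> rcases v with _ | ⟨i', j'⟩ <;> simp [toTree]
  have hlr' : ∀ u v, par σ (S.toTree false (Sum.inl : Fin S.legs.length → I) u) ≠
      some (S'.toTree true (Sum.inr : Fin S'.legs.length → I) v) := by
    intro u v
    rcases S with _ | ⟨L, pos⟩
    · cases u
    rcases S' with _ | ⟨L', pos'⟩
    · cases v
    rcases u with _ | ⟨i, _ | j, hj⟩ <;> rcases v with _ | ⟨i', j'⟩ <;> simp [toTree, par, σ]
    rfl
  have hrl' : ∀ u v, par σ (S'.toTree true (Sum.inr : Fin S'.legs.length → I) v) ≠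
      some (S.toTree false (Sum.inl : Fin S.legs.length → I) u) := by
    intro u v
    rcases S with _ | ⟨L, pos⟩
    · cases u
    rcases S' with _ | ⟨L', pos'⟩
    · cases v
    rcases u with _ | ⟨i, j⟩ <;> rcases v with _ | ⟨i', _ | j', hj'⟩ <;> simp [toTree, par, σ]
    rfl
  have hg : Function.Injective g := by
    rintro (u | u | u) (v | v | v) h
    · exact congrArg _ (S.toTree_injective false hl h)
    · exact absurd h (toTree_ne_mid u)
    · exact absurd h (hlr u v)
    · exact absurd h.symm (toTree_ne_mid v)
    · rfl
    · exact absurd h.symm (toTree_ne_mid v)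
    · exact absurd h.symm (hlr v u)
    · exact absurd h (toTree_ne_mid u)
    · exact congrArg _ (congrArg _ (S'.toTree_injective true hr h))
  have hadj : ∀ u v, (forestGraph (par σ)).Adj (g u) (g v) ↔ (S.bistar S').Adj u v := by
    rintro (u | u | u) (v | v | v) <;> rw [bistar, SimpleGraph.fromRel_adj]
    · refine (toTree_adj hl (fun _ => rfl) u v).trans ?_
      simp only [BistarStep, S.graph.adj_comm v u, or_self]
      exact ⟨fun h => ⟨by simpa using h.ne, h⟩, And.right⟩
    · rw [forestGraph_adj (depth_lt σ)]
      simp [g, BistarStep, par_toTree_eq_mid, par_mid]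
    · rw [forestGraph_adj (depth_lt σ)]
      simp [g, BistarStep, hlr', hrl']
    · rw [forestGraph_adj (depth_lt σ)]
      simp [g, BistarStep, par_toTree_eq_mid, par_mid]
    · simp [g, BistarStep]
    · rw [forestGraph_adj (depth_lt σ)]
      simp [g, BistarStep, par_toTree_eq_mid, par_mid]
    · rw [forestGraph_adj (depth_lt σ)]
      simp [g, BistarStep, hlr', hrl']
    · rw [forestGraph_adj (depth_lt σ)]
      simp [g, BistarStep, par_toTree_eq_mid, par_mid]
    · refine (toTree_adj hr (fun _ => rfl) u v).trans ?_
      simp only [BistarStep, S'.graph.adj_comm v u, or_self]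
      exact ⟨fun h => ⟨by simpa using h.ne, h⟩, And.right⟩
  let φ : S.bistar S' ↪g forestGraph (par σ) :=
    { toFun := g
      inj' := hg
      map_rel_iff' := hadj _ _ }
  have hW : IsShape (Finset.univ.map φ.toEmbedding) c true f := by
    refine ⟨?_, fun t => ?_, fun i j => ?_⟩
    · simp only [Finset.mem_map, Finset.mem_univ, true_and, iff_true]
      exact ⟨.inr (.inl ()), rfl⟩
    · have h1 := exists_toTree_eq_cen (S := S) (s := false) (e := (Sum.inl : _ → I)) t
      have h2 := exists_toTree_eq_cen (S := S') (s := true) (e := (Sum.inr : _ → I)) t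
      cases t <;> simp_all [φ, g, c]
    · have h1 := exists_toTree_eq_leg (S := S) (s := false) (e := (Sum.inl : _ → I)) i j
      have h2 := exists_toTree_eq_leg (S := S') (s := true) (e := (Sum.inr : _ → I)) i j
      rcases i with i | i <;> simp_all [φ, g, f]
  have ha : Attached σ c f := by
    rintro (i | i) hi
    · have h := legs_eq_nil (S := S) (by simpa [c, σ] using hi)
      exact absurd i.2 (by simp [h])
    · have h := legs_eq_nil (S := S') (by simpa [c, σ] using hi)
      exact absurd i.2 (by simp [h])
  rw [grundyValue, ← grundy_map φ]
  refine (hW.grundy_bistar ha).trans ?_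
  rw [S.starClass_eq_cls ⟨Sum.inl, hl⟩ (by rintro (i | i) <;> simp [σ]) (fun _ => rfl) rfl,
    S'.starClass_eq_cls ⟨Sum.inr, hr⟩ (by rintro (i | i) <;> simp [σ]) (fun _ => rfl) rfl]

end SubdividedStar

/-! ### The classes -/

namespace StarClass

/-- The four columns `d0`, `d0s`, `d1s`, `d2s` already separate the rows of the table. -/
theorem eq_of_val₂_eq {c c' : StarClass} (h : ∀ d, val₂ c d = val₂ c' d) : c = c' := by
  cases c <;> cases c' <;> first
    | rfl
    | exact absurd (h .d0) (by decide)
    | exact absurd (h .d0s) (by decide)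
    | exact absurd (h .d1s) (by decide)
    | exact absurd (h .d2s) (by decide)

theorem replicate_add_replicate_inj {a b a' b' : ℕ} :
    Multiset.replicate a 1 + Multiset.replicate b 2 =
      Multiset.replicate a' 1 + Multiset.replicate b' 2 ↔ a = a' ∧ b = b' := by
  refine ⟨fun h => ⟨?_, ?_⟩, by rintro ⟨rfl, rfl⟩; rfl⟩
  · simpa [Multiset.count_replicate] using congrArg (Multiset.count 1) h
  · simpa [Multiset.count_replicate] using congrArg (Multiset.count 2) h

/-- The special classes in terms of the numbers of paths of length 1 and 2 modulo 3. -/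
def SpecialCounts (a b : ℕ) : StarClass → Prop
  | d0s => ((ofCounts a b).val = 0 ∧ (b = 0 ∨ b = 2)) ∨ (a = 0 ∧ b = 1)
  | d1s => (a = 0 ∧ b = 0) ∨ (a = 1 ∧ b = 1) ∨ (a = 0 ∧ b = 3)
  | d1b => (ofCounts a b).val = 1 ∧ (b = 0 ∨ b = 2) ∧ ¬ (a = 0 ∧ b = 0)
  | d2s => (a = 1 ∧ b = 0) ∨ (a = 0 ∧ b = 2)
  | d2b => (ofCounts a b).val = 2 ∧ (b = 1 ∨ b = 3)
  | d3b => (ofCounts a b).val = 3 ∧ (b = 1 ∨ b = 3)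
  | _ => False

/-- The classes that are not special. -/
def Plain : StarClass → Prop
  | d0 | d1 | d2 | d3 => True
  | _ => False

/-- The special conditions see only the parities and the small values of `a` and `b`, so finitely
many cases remain. In particular they are mutually exclusive. -/
theorem specialCounts_iff (a b : ℕ) (c : StarClass) :
    SpecialCounts a b c ↔ ofCounts a b = c ∧ ¬ c.Plain := by
  rcases Nat.mod_two_eq_zero_or_one a with ha | ha <;>
    rcases Nat.mod_two_eq_zero_or_one b with hb | hb <;>
    rcases a with _ | _ | a <;> rcases b with _ | _ | _ | _ | b <;>
    cases c <;> simp [SpecialCounts, Plain, ofCounts, val, ha, hb]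

theorem special_star_iff (paths : List ℕ) (pos : ∀ l ∈ paths, 1 ≤ l) (c : StarClass) :
    Special c (.star paths pos) ↔
      SpecialCounts (paths.countP (· % 3 = 1)) (paths.countP (· % 3 = 2)) c := by
  have hv : (SubdividedStar.star paths pos).value = _ := SubdividedStar.value_eq _
  have ht : (SubdividedStar.star paths pos).numTwo = paths.countP (· % 3 = 2) := by
    rw [SubdividedStar.numTwo, List.count, List.countP_map]
    congr 1
  -- A reduction is a multiset of ones and twos, hence is determined by the two counts.
  have hr (a b : ℕ) : (SubdividedStar.star paths pos).ReducesTo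
      (Multiset.replicate a 1 + Multiset.replicate b 2) ↔
      paths.countP (· % 3 = 1) = a ∧ paths.countP (· % 3 = 2) = b := by
    rw [SubdividedStar.ReducesTo, ← replicate_add_replicate_inj]
    refine Eq.congr_left ?_
    clear hv ht pos
    induction paths with
    | nil => rfl
    | cons l L ih =>
      have h3 : l % 3 < 3 := Nat.mod_lt _ (by norm_num)
      rw [List.map_cons, List.countP_cons, List.countP_cons]
      interval_cases l % 3
      · simpa using ih
      · rw [List.filter_cons_of_pos (by simp), ← Multiset.cons_coe, ih]
        simp [Multiset.replicate_succ]
      · rw [List.filter_cons_of_pos (by simp), ← Multiset.cons_coe, ih]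
        simp [Multiset.replicate_succ]
  have h00 := hr 0 0
  have h01 := hr 0 1
  have h11 := hr 1 1
  have h03 := hr 0 3
  have h10 := hr 1 0
  have h02 := hr 0 2
  rw [show Multiset.replicate 0 1 + Multiset.replicate 0 2 = (0 : Multiset ℕ) from rfl] at h00
  rw [show Multiset.replicate 0 1 + Multiset.replicate 1 2 = ({2} : Multiset ℕ) from rfl] at h01
  rw [show Multiset.replicate 1 1 + Multiset.replicate 1 2 = ({2, 1} : Multiset ℕ) by decide] at h11
  rw [show Multiset.replicate 0 1 + Multiset.replicate 3 2 = ({2, 2, 2} : Multiset ℕ) from rfl]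
    at h03
  rw [show Multiset.replicate 1 1 + Multiset.replicate 0 2 = ({1} : Multiset ℕ) from rfl] at h10
  rw [show Multiset.replicate 0 1 + Multiset.replicate 2 2 = ({2, 2} : Multiset ℕ) from rfl] at h02
  rw [SubdividedStar.cls] at hv
  cases c <;> simp only [Special, SpecialCounts, h00, h01, h11, h03, h10, h02, hv, ht]

theorem special_iff (S : SubdividedStar) (c : StarClass) :
    Special c S ↔ S.cls = c ∧ ¬ c.Plain := by
  rcases S with _ | ⟨paths, pos⟩
  · have hv := SubdividedStar.value_eq .empty
    cases c <;> simp [Special, SubdividedStar.numTwo, SubdividedStar.ReducesTo,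
      SubdividedStar.cls, Plain, hv, val]
  · rw [special_star_iff, specialCounts_iff, SubdividedStar.cls]

/-- Each Grundy value from 0 to 3 belongs to exactly one plain class, so the value and the absence
of special properties determine it. -/
theorem mem_stars_iff (c : StarClass) (S : SubdividedStar) : S ∈ c.stars ↔ S.cls = c := by
  have hv := S.value_eq
  cases c <;> simp only [stars, Set.mem_ofPred_eq, special_iff, hv] <;>
    generalize S.cls = d <;> cases d <;> simp [val, Plain]

/-- Inhabitants serve as test stars in `sim2_iff`, and show that the ten sets are nonempty and
therefore distinct. -/
theorem exists_cls_eq (c : StarClass) : ∃ S : SubdividedStar, S.cls = c := by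
  cases c
  · exact ⟨.star [2, 2, 2, 2] (by simp), rfl⟩
  · exact ⟨.empty, rfl⟩
  · exact ⟨.star [2, 2, 2, 2, 1] (by simp), rfl⟩
  · exact ⟨.star [] (by simp), rfl⟩
  · exact ⟨.star [1, 1, 1] (by simp), rfl⟩
  · exact ⟨.star [2, 2, 2, 2, 2] (by simp), rfl⟩
  · exact ⟨.star [1] (by simp), rfl⟩
  · exact ⟨.star [2, 1, 1] (by simp), rfl⟩
  · exact ⟨.star [2, 2, 2, 2, 2, 1] (by simp), rfl⟩
  · exact ⟨.star [2, 1, 1, 1] (by simp), rfl⟩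

end StarClass

theorem SubdividedStar.sim2_iff (S S' : SubdividedStar) : Sim2 S S' ↔ S.cls = S'.cls := by
  simp only [Sim2, gameEquiv_iff, grundyValue_bistar]
  refine ⟨fun h => StarClass.eq_of_val₂_eq fun d => ?_, fun h T => by rw [h]⟩
  obtain ⟨T, rfl⟩ := StarClass.exists_cls_eq d
  exact h T

theorem mainTheorem5 :
    (∃ h : Equivalence SubdividedStar.Sim2,
      Setoid.classes ⟨SubdividedStar.Sim2, h⟩ = Set.range StarClass.stars ∧
      Function.Injective StarClass.stars) ∧
    (∀ (c c' : StarClass) (S S' : SubdividedStar), S ∈ c.stars → S' ∈ c'.stars →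
      grundyValue (S.bistar S') = StarClass.table c c' S.value S'.value) := by
  have hset (S : SubdividedStar) : S.cls.stars = {T | SubdividedStar.Sim2 T S} := by
    ext T
    rw [StarClass.mem_stars_iff, Set.mem_ofPred_eq, SubdividedStar.sim2_iff]
  refine ⟨⟨⟨fun S => ?_, fun {S T} h => ?_, fun {S T U} h h' => ?_⟩, ?_, fun c c' h => ?_⟩, ?_⟩
  · exact (SubdividedStar.sim2_iff _ _).2 rfl
  · rw [SubdividedStar.sim2_iff] at h ⊢
    exact h.symm
  · rw [SubdividedStar.sim2_iff] at h h' ⊢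
    exact h.trans h'
  · ext A
    constructor
    · rintro ⟨S, rfl⟩
      exact ⟨S.cls, hset S⟩
    · rintro ⟨c, rfl⟩
      obtain ⟨S, rfl⟩ := StarClass.exists_cls_eq c
      exact ⟨S, hset S⟩
  · obtain ⟨S, rfl⟩ := StarClass.exists_cls_eq c
    have hS : S ∈ S.cls.stars := (StarClass.mem_stars_iff _ _).2 rfl
    rw [h] at hS
    exact (StarClass.mem_stars_iff _ _).1 hS
  · intro c c' S S' hS hS'
    obtain rfl := (StarClass.mem_stars_iff _ _).1 hS
    obtain rfl := (StarClass.mem_stars_iff _ _).1 hS'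
    rw [SubdividedStar.grundyValue_bistar, S.value_eq, S'.value_eq]
    rfl
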